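/- Let $N\ge 0$, $p\ge 1$, and consider for $t\ge 0$ the system $$x^{(n)}=f(x,\dot x,\dots,x^{(n-1)},t),\qquad x(t)\in\mathbb R^N .$$ For $j=1,\dots,p$ let $\Lambda_j(z_j,t)$ be an integrable contraction rate matrix: a complex $N\times N$ matrix, continuous in $(z_j,t)$, which is the derivative with respect to $z_j$ of a continuous function $\int\Lambda_j\,dz_j$ of $(z_j,t)$ (the time-varying integration constant is part of the choice). If $\Lambda_j$ is a complex rate, $z_j$ ranges over $\mathbb C^N$; if it is a real rate, $z_j$ and $\int\Lambda_j\,dz_j$ are real. Let $d(z_p,\dots,z_1,t)$ be continuous, with a derivative in $(z_1,\dots,z_p)$ that is continuous in $(z_1,\dots,z_p,t)$ ($d$ takes its values in the space of $z_p$; derivatives are real derivatives). Suppose that the system is written as the distorted characteristic equation $$\dot z_j=\int\Lambda_j\,dz_j+\Re(z_{j+1})\ \ (1\le j<p),\qquad \dot z_p=\int\Lambda_p\,dz_p+d(z_p,\dots,z_1,t),\qquad \Re(z_1)=x,$$ that is, the solutions $x$ on $t\ge0$ of the system are exactly the functions $\Re(z_1)$ with $(z_1,\dots,z_p)$ a solution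 of these equations, and $p$ is $n$ minus the number of complex rates. Suppose that for every initial state the solution $z$ exists for all $t\ge 0$. Let $\lambda_{\max}(z_1,\dots,z_p,t)$ be the largest eigenvalue of the Hermitian parts of all the matrices $\Lambda_1(z_1,t),\dots,\Lambda_p(z_p,t)$; let $|\cdot|$ be the Euclidean norm of a vector and the largest singular value of a matrix. Let $\eta(z_1,\dots,z_p,t)$ be real, and let $L^0\eta=1$, $L^{j+1}\eta=\frac{d}{dt}(L^j\eta)+\eta\,L^j\eta$, with time derivatives along trajectories. Suppose that along every trajectory $\eta$ is $p-1$ times continuously differentiable in $t\ge 0$, and that for all $t\ge0$ one has $L^j\eta\ge 0$ for $0\le j\le p$ and $$L^p\eta\ \ge\ \Big|\frac{\partial d}{\partial z_p}\Big|\,L^{p-1}\eta+\dots+\Big|\frac{\partial d}{\partial z_1}\Big|\,L^{0}\eta .$$ For each $t\ge0$ the state $z(t)$ is then a differentiable function of the initial state $z(0)$, $\eta+\lambda_{\max}$ is continuous in $t\ge0$ along every trajectory, and the virtual displacements $\delta z(t)=\frac{\partial z(t)}{\partial z(0)}\,\delta z(0)$ have the following properties (global contraction behaviour with the rates $\Lambda_j+\eta$).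 1. For all $t_0\ge0$ and $K\ge0$: if $|\delta z_j(t_0)|\le K\,L^{j-1}\eta(t_0)$ for $1\le j\le p$, then for all $t\ge t_0$ $$|\delta z_j(t)|\le K\,L^{j-1}\eta(t)\,e^{\int_{t_0}^t(\eta+\lambda_{\max})\,d\tau},\qquad 1\le j\le p .$$ 2. If $L^{j-1}\eta(0)>0$ for $1\le j\le p$ along a trajectory, then for every $\delta z(0)$ there is a constant $K>0$ for which the bound of 1 with $t_0=0$ holds for all $t\ge 0$. If moreover every $L^{j-1}\eta$, $1\le j\le p$, is bounded on $t\ge0$ along the trajectory, there is a constant $K>0$ with $$|\delta z_j(t)|\le K\,L^{j-1}\eta(0)\,e^{\int_0^t(\eta+\lambda_{\max})\,d\tau},\qquad 1\le j\le p,\ t\ge0 .$$ 3. Finite distances: let $\gamma:\mathbb R\to\{\text{initial states}\}$ be a $C^1$ path, let $z^s$ be the trajectory that starts at $\gamma(s)$, and let $\delta z^s(t)$ be the virtual displacement along $z^s$ with $\delta z^s(0)=\gamma'(s)$. Then $|z^0_j(t)-z^1_j(t)|\le\int_0^1|\delta z^s_j(t)|\,ds$ for all $t\ge0$ and $1\le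 j\le p$. If $t_0\ge0$ and $K(s)\ge 0$ satisfy $|\delta z^s_j(t_0)|\le K(s)\,L^{j-1}\eta(t_0)$ for $1\le j\le p$ and $0\le s\le1$, then for all $t\ge t_0$ and $1\le j\le p$ $$\int_0^1|\delta z^s_j(t)|\,ds\ \le\ \int_0^1K(s)\,L^{j-1}\eta(t)\,e^{\int_{t_0}^t(\eta+\lambda_{\max})\,d\tau}\,ds ,$$ with $\eta$, $L^{j-1}\eta$ and $\lambda_{\max}$ taken along $z^s$. 4. Suppose that $L^{j-1}\eta(0)\ge m>0$ for $1\le j\le p$ along all trajectories, and that $\eta+\lambda_{\max}\le\beta$ along all trajectories for all $t\ge0$. Then for any two solutions $x,y$ of the system there is a constant $C$ with $|x(t)-y(t)|\le C\,e^{\beta t}$ for all $t\ge 0$. If moreover $L^{j-1}\eta\le M$ for $1\le j\le p$ along all trajectories for all $t\ge0$, then for any two trajectories $z,z'$ there is a constant $C$ with $|z_j(t)-z'_j(t)|\le C\,e^{\beta t}$ for $1\le j\le p$ and $t\ge0$. -/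

import Mathlib

open Set

noncomputable section

namespace Contraction

/-- The position space `ℝ^N` with the Euclidean norm. -/
abbrev Pos (N : ℕ) : Type := EuclideanSpace ℝ (Fin N)

/-- The complex space `ℂ^N` with the norm `√(z^* z)`. -/
abbrev CPos (N : ℕ) : Type := EuclideanSpace ℂ (Fin N)

/-- The values that a modal coordinate `z_j` may take: all of `ℂ^N` if its contraction rate
matrix is complex (`b = true`), the real vectors in `ℂ^N` if it is real (`b = false`). -/
def levelSubspace (N : ℕ) (b : Bool) : Submodule ℝ (CPos N) where
  carrier := {v | b = false → ∀ i, (v i).im = 0}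
  add_mem' := by
    intro v w hv hw hb i
    simp [hv hb i, hw hb i]
  zero_mem' := by
    intro _ i
    simp
  smul_mem' := by
    intro r v hv hb i
    simp [hv hb i]

/-- The space of a modal coordinate. -/
abbrev Level (N : ℕ) (b : Bool) : Type := levelSubspace N b

/-- The state `(z_1, …, z_p)`; the coordinate `z_{j+1}` of the mathematics is the component with
index `j : Fin p`, whose rate matrix is complex if and only if `c j = true`. -/
abbrev State (N p : ℕ) (c : Fin p → Bool) : Type := ∀ j : Fin p, Level N (c j)

/-- The real part of a complex vector, as a real vector. -/
def rePos {N : ℕ} (v : CPos N) : Pos N := WithLp.toLp 2 fun i => (v i).re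

/-- A real vector regarded as a complex vector. -/
def ofPos {N : ℕ} (x : Pos N) : CPos N := WithLp.toLp 2 fun i => ((x i : ℝ) : ℂ)

/-- The Hermitian part `(A + A^*)/2` of a complex square matrix. -/
def hermPart {N : ℕ} (A : Matrix (Fin N) (Fin N) ℂ) : Matrix (Fin N) (Fin N) ℂ :=
  (1 / 2 : ℂ) • (A + A.conjTranspose)

theorem hermPart_isHermitian {N : ℕ} (A : Matrix (Fin N) (Fin N) ℂ) :
    (hermPart A).IsHermitian := by
  unfold hermPart Matrix.IsHermitian
  rw [Matrix.conjTranspose_smul, Matrix.conjTranspose_add, Matrix.conjTranspose_conjTranspose,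
    add_comm]
  simp

/-- The real-linear map `v ↦ A v` from the space of a modal coordinate to `ℂ^N`. -/
def levelMap {N : ℕ} (b : Bool) (A : Matrix (Fin N) (Fin N) ℂ) : Level N b →L[ℝ] CPos N :=
  ((Matrix.toEuclideanCLM (𝕜 := ℂ) A).restrictScalars ℝ).comp (levelSubspace N b).subtypeL

/-- The data of a distorted characteristic equation: integrable contraction rate matrices
`Λ_j(z_j, t)`, their integrals `∫ Λ_j dz_j` (a function `prim j` of `(z_j, t)` whose
derivative with respect to `z_j` is `Λ_j`; the time-varying integration constant is part of it)
and the distortion `d(z_p, …, z_1, t)`, for `t ≥ 0`. -/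
structure DistortedSystem (N p : ℕ) where
  /-- `cplx j = true` if and only if the `j`-th rate matrix counts as complex -/
  cplx : Fin p → Bool
  /-- the contraction rate matrices -/
  rate : ∀ j : Fin p, Level N (cplx j) → ℝ → Matrix (Fin N) (Fin N) ℂ
  /-- the integrals of the contraction rate matrices -/
  prim : ∀ j : Fin p, Level N (cplx j) → ℝ → CPos N
  /-- the distortion -/
  dist : State N p cplx → ℝ → CPos N
  prim_mem : ∀ j z t, prim j z t ∈ levelSubspace N (cplx j)
  dist_mem : ∀ j : Fin p, (j : ℕ) + 1 = p → ∀ z t, dist z t ∈ levelSubspace N (cplx j)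
  hasFDerivAt_prim : ∀ j z t, 0 ≤ t →
    HasFDerivAt (fun w => prim j w t) (levelMap (cplx j) (rate j z t)) z
  continuousOn_prim : ∀ j,
    ContinuousOn (fun q : Level N (cplx j) × ℝ => prim j q.1 q.2) (univ ×ˢ Ici 0)
  continuousOn_rate : ∀ j,
    ContinuousOn (fun q : Level N (cplx j) × ℝ => rate j q.1 q.2) (univ ×ˢ Ici 0)
  differentiable_dist : ∀ t, 0 ≤ t → Differentiable ℝ fun z => dist z t
  continuousOn_dist :
    ContinuousOn (fun q : State N p cplx × ℝ => dist q.1 q.2) (univ ×ˢ Ici 0)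
  continuousOn_fderiv_dist :
    ContinuousOn (fun q : State N p cplx × ℝ => fderiv ℝ (fun z => dist z q.2) q.1)
      (univ ×ˢ Ici 0)

namespace DistortedSystem

variable {N p : ℕ} (S : DistortedSystem N p)

/-- The number of complex contraction rate matrices. -/
def numComplex : ℕ := (Finset.univ.filter fun j => S.cplx j = true).card

/-- What drives the `j`-th equation: the real part of the next coordinate, and in the last
equation the distortion. -/
def drive (z : State N p S.cplx) (t : ℝ) (j : Fin p) : CPos N :=
  if h : (j : ℕ) + 1 < p then ofPos (rePos (z ⟨(j : ℕ) + 1, h⟩ : CPos N)) else S.dist z t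

/-- `z` solves the distorted characteristic equation for `t ≥ 0`:
`ż_j = ∫ Λ_j dz_j + Re z_{j+1}` for `j < p` and `ż_p = ∫ Λ_p dz_p + d(z_p, …, z_1, t)`. -/
def IsSolution (z : ℝ → State N p S.cplx) : Prop :=
  ∀ t, 0 ≤ t → ∀ j : Fin p,
    HasDerivWithinAt (fun τ => (z τ j : CPos N)) (S.prim j (z t j) t + S.drive (z t) t j)
      (Ici 0) t

/-- `Z z₀` is the solution that starts at `z₀` at time `0`; such a `Z` exists if and only if
all solutions extend to all `t ≥ 0`. -/
def IsFlow (Z : State N p S.cplx → ℝ → State N p S.cplx) : Prop :=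
  ∀ z₀, S.IsSolution (Z z₀) ∧ Z z₀ 0 = z₀

/-- The norm (largest singular value) of the partial derivative `∂d/∂z_j`. -/
def normPartial (z : State N p S.cplx) (t : ℝ) (j : Fin p) : ℝ :=
  ‖fderiv ℝ (fun w => S.dist (Function.update z j w) t) (z j)‖

/-- The largest eigenvalue of the Hermitian parts of all the matrices `Λ_j(z_j, t)`. -/
def lamMax (z : State N p S.cplx) (t : ℝ) : ℝ :=
  ⨆ q : Fin p × Fin N, (hermPart_isHermitian (S.rate q.1 (z q.1) t)).eigenvalues q.2

end DistortedSystem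

/-- `x` is a solution on `t ≥ 0` of `x^(n) = f(x, ẋ, …, x^(n-1), t)`. -/
def IsNthOrderSolution {N : ℕ} (n : ℕ) (f : (Fin n → Pos N) → ℝ → Pos N) (x : ℝ → Pos N) : Prop :=
  ContDiffOn ℝ n x (Ici 0) ∧
    ∀ t, 0 ≤ t → iteratedDerivWithin n x (Ici 0) t =
      f (fun k => iteratedDerivWithin (k : ℕ) x (Ici 0) t) t

/-- The system `x^(n) = f(x, ẋ, …, x^(n-1), t)` is written as the distorted characteristic
equation `S` with `Re z_1 = x`: the solutions of the one are the real parts of the first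
coordinates of the solutions of the other, and `p` is `n` minus the number of complex contraction
rate matrices. -/
def IsDistortedForm {N p : ℕ} [NeZero p] (n : ℕ) (f : (Fin n → Pos N) → ℝ → Pos N)
    (S : DistortedSystem N p) : Prop :=
  n = p + S.numComplex ∧
    ∀ x : ℝ → Pos N, IsNthOrderSolution n f x ↔
      ∃ z, S.IsSolution z ∧ ∀ t, 0 ≤ t → x t = rePos (z t 0 : CPos N)

/-- The iterates `L^0 h = 1`, `L^{j+1} h = (L^j h)˙ + h L^j h` for a function `h` of `t ≥ 0`. -/
def iterL (h : ℝ → ℝ) : ℕ → ℝ → ℝ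
  | 0 => fun _ => 1
  | j + 1 => fun t => derivWithin (iterL h j) (Ici 0) t + h t * iterL h j t

section Flow

variable {N p : ℕ} {c : Fin p → Bool}

/-- The virtual displacement `δz(t) = (∂z(t)/∂z(0)) δz(0)` at time `t` along the trajectory that
starts at `z₀`, with `δz(0) = v`. -/
def virtualDisplacement (Z : State N p c → ℝ → State N p c) (z₀ v : State N p c) (t : ℝ) :
    State N p c :=
  fderiv ℝ (fun w => Z w t) z₀ v

/-- A function of state and time, evaluated along the trajectory that starts at `z₀`. -/
def along (Z : State N p c → ℝ → State N p c) (φ : State N p c → ℝ → ℝ) (z₀ : State N p c) :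
    ℝ → ℝ :=
  fun t => φ (Z z₀ t) t

/-- The length, in the `j`-th coordinate and at time `t`, of the path formed by the trajectories
that start on the path `γ`. -/
def transportedLength (Z : State N p c → ℝ → State N p c) (γ : ℝ → State N p c) (t : ℝ)
    (j : Fin p) : ENNReal :=
  ∫⁻ s in Icc (0 : ℝ) 1, ‖virtualDisplacement Z (γ s) (deriv γ s) t j‖ₑ

end Flow

/-- The hypothesis on `η` along every trajectory: `L^1 η, …, L^p η` exist and are nonnegative and
`L^p η ≥ |∂d/∂z_p| L^{p-1} η + … + |∂d/∂z_1| L^0 η`. -/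
def IsDistortionBound {N p : ℕ} (S : DistortedSystem N p)
    (Z : State N p S.cplx → ℝ → State N p S.cplx) (η : State N p S.cplx → ℝ → ℝ) : Prop :=
  ∀ z₀, ContDiffOn ℝ ((p - 1 : ℕ) : WithTop ℕ∞) (along Z η z₀) (Ici 0) ∧
    ∀ t, 0 ≤ t →
      (∀ j ≤ p, 0 ≤ iterL (along Z η z₀) j t) ∧
      ∑ j : Fin p, S.normPartial (Z z₀ t) t j * iterL (along Z η z₀) j t ≤
        iterL (along Z η z₀) p t

/-- The factor `exp (∫_{t₀}^t (η + λ_max))` along the trajectory that starts at `z₀`. -/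
def growth {N p : ℕ} (S : DistortedSystem N p) (Z : State N p S.cplx → ℝ → State N p S.cplx)
    (η : State N p S.cplx → ℝ → ℝ) (z₀ : State N p S.cplx) (t₀ t : ℝ) : ℝ :=
  Real.exp (∫ τ in t₀..t, (along Z η z₀ τ + along Z S.lamMax z₀ τ))

end Contraction

end

/-! Differentiating the equations in the initial state gives the variational equation: δż_j = Λ_j
δz_j + Re δz_{j+1} for j < p, and δż_p = Λ_p δz_p + Σ_k (∂d/∂z_k) δz_k. The Hermitian part of Λ_j
bounds the growth of |δz_j| by λ_max, and taking real parts does not increase norms. So the norms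
|δz_j| obey a linear system of differential inequalities with nonnegative coupling coefficients: 1
to the next level, and |∂d/∂z_k| in the last row.

The functions W_j = K L^{j-1}η exp ∫(η + λ_max) form a supersolution of that system. Since
(L^{j-1}η)˙ = L^j η - η L^{j-1}η, the terms in η cancel and W_j˙ = λ_max W_j + K L^j η exp ∫(η +
λ_max). For j < p the last term is W_{j+1}; for j = p the hypothesis on L^p η says that it dominates
Σ_k |∂d/∂z_k| W_k. As the couplings are nonnegative, |δz_j| ≤ W_j persists once it holds at t₀
(`norm_le_of_coupled_deriv_le`, applied in `norm_virtualDisplacement_le`).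

The variational equation itself rests on differentiability of the flow
(`exists_hasFDerivAt_flow_Icc`), which needs only a vector field whose state derivative is jointly
continuous. Finite distances follow by integrating displacements along a path of initial states. The
first coordinate carries the weight L^0 η = 1, so solutions x need no upper bound on the other L^j
η. -/

noncomputable section

namespace Contraction

/-! ### Linear differential equations with continuous coefficients -/

section LinearODE

variable {V : Type*} [NormedAddCommGroup V] [NormedSpace ℝ V]

/-- Local solvability of a bounded linear equation, with a step that does not depend on the
initial value. -/
theorem exists_linear_ode_step [CompleteSpace V] {A : ℝ → V →L[ℝ] V} (hA : Continuous A) {B : ℝ}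
    (hB : 0 < B) (hAB : ∀ t, ‖A t‖ ≤ B) (a : ℝ) (x₀ : V) :
    ∃ y : ℝ → V, y a = x₀ ∧ ∀ t ∈ Icc a (a + 1 / (2 * B)),
      HasDerivWithinAt y (A t (y t)) (Icc a (a + 1 / (2 * B))) t := by
  lift B to NNReal using hB.le
  have hh : 0 < 1 / (2 * (B : ℝ)) := by positivity
  -- On the ball of radius ‖x₀‖ about x₀ the field is at most 2B‖x₀‖, so during time 1/(2B) a
  -- solution moves at most ‖x₀‖. Scaling the ball with x₀ makes the step independent of x₀.
  have key : IsPicardLindelof (fun t x => A t x)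
      (⟨a, left_mem_Icc.2 (by linarith)⟩ : Icc a (a + 1 / (2 * (B : ℝ)))) x₀
      ‖x₀‖₊ 0 (B * (2 * ‖x₀‖₊)) B := by
    refine ⟨fun t _ => ?_, fun x _ => ?_, fun t _ x hx => ?_, ?_⟩
    · exact ((A t).lipschitz.weaken (by exact_mod_cast hAB t)).lipschitzOnWith
    · exact (hA.clm_apply continuous_const).continuousOn
    · have h1 : ‖x‖ ≤ 2 * ‖x₀‖ := by
        have h2 : ‖x - x₀‖ ≤ ‖x₀‖ := by simpa [dist_eq_norm] using hx
        have h3 := norm_add_le (x - x₀) x₀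
        rw [sub_add_cancel] at h3
        linarith
      have h4 := (A t).le_opNorm x
      have h5 : ‖A t‖ * ‖x‖ ≤ B * (2 * ‖x₀‖) :=
        mul_le_mul (hAB t) h1 (norm_nonneg _) hB.le
      simpa using h4.trans h5
    · rw [sub_self, add_sub_cancel_left, max_eq_left hh.le]
      apply le_of_eq
      push_cast
      field_simp
      rw [sub_zero]
  obtain ⟨y, hy, hy'⟩ := key.exists_eq_forall_mem_Icc_hasDerivWithinAt₀
  exact ⟨y, hy, hy'⟩

/-- Two solutions on adjacent intervals glue to one. -/
theorem hasDerivWithinAt_glue {y₁ y₂ : ℝ → V} {f : ℝ → V → V} {a b c : ℝ} (hab : a ≤ b)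
    (hbc : b ≤ c) (h : y₂ b = y₁ b)
    (h₁ : ∀ t ∈ Icc a b, HasDerivWithinAt y₁ (f t (y₁ t)) (Icc a b) t)
    (h₂ : ∀ t ∈ Icc b c, HasDerivWithinAt y₂ (f t (y₂ t)) (Icc b c) t) :
    ∃ y : ℝ → V, y a = y₁ a ∧
      ∀ t ∈ Icc a c, HasDerivWithinAt y (f t (y t)) (Icc a c) t := by
  classical
  set y : ℝ → V := fun t => if t ≤ b then y₁ t else y₂ t with hy
  have e₁ : ∀ t, t ≤ b → y t = y₁ t := fun t ht => by simp [hy, ht]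
  have e₂ : ∀ t, b ≤ t → y t = y₂ t := fun t ht => by
    rcases ht.eq_or_lt with rfl | ht
    · simp [hy, h]
    · simp [hy, not_le.2 ht]
  have d₁ : ∀ t ∈ Icc a b, HasDerivWithinAt y (f t (y t)) (Icc a b) t := fun t ht => by
    rw [e₁ t ht.2]
    exact (h₁ t ht).congr (fun s hs => e₁ s hs.2) (e₁ t ht.2)
  have d₂ : ∀ t ∈ Icc b c, HasDerivWithinAt y (f t (y t)) (Icc b c) t := fun t ht => by
    rw [e₂ t ht.1]
    exact (h₂ t ht).congr (fun s hs => e₂ s hs.1) (e₂ t ht.1)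
  refine ⟨y, e₁ a hab, fun t ht => ?_⟩
  rcases lt_trichotomy t b with htb | rfl | htb
  · refine (d₁ t ⟨ht.1, htb.le⟩).mono_of_mem_nhdsWithin ?_
    refine mem_nhdsWithin.2 ⟨Iio b, isOpen_Iio, htb, fun s hs => ⟨hs.2.1, hs.1.le⟩⟩
  · rw [← Icc_union_Icc_eq_Icc hab hbc]
    exact (d₁ t ⟨hab, le_rfl⟩).union (d₂ t ⟨le_rfl, hbc⟩)
  · refine (d₂ t ⟨htb.le, ht.2⟩).mono_of_mem_nhdsWithin ?_
    refine mem_nhdsWithin.2 ⟨Ioi b, isOpen_Ioi, htb, fun s hs => ⟨hs.1.le, hs.2.2⟩⟩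

/-- Global solvability of a linear equation with continuous coefficients. -/
theorem exists_linear_ode [CompleteSpace V] {A : ℝ → V →L[ℝ] V} {T : ℝ} (hT : 0 ≤ T)
    (hA : ContinuousOn A (Icc 0 T)) (x₀ : V) :
    ∃ y : ℝ → V, y 0 = x₀ ∧ ∀ t ∈ Icc 0 T, HasDerivWithinAt y (A t (y t)) (Icc 0 T) t := by
  -- Freezing the coefficient outside [0, T] makes it continuous and bounded on ℝ, so the last step
  -- may overshoot T.
  set A' : ℝ → V →L[ℝ] V := fun t => A (projIcc 0 T hT t) with hA'
  have hA'c : Continuous A' := hA.domRestrict.comp continuous_projIcc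
  have hA'e : ∀ t ∈ Icc 0 T, A' t = A t := fun t ht => by simp [hA', projIcc_of_mem hT ht]
  obtain ⟨C, hC⟩ := isCompact_Icc.exists_bound_of_continuousOn hA
  set B := max C 1 with hBdef
  have hB : 0 < B := lt_of_lt_of_le one_pos (le_max_right _ _)
  have hAB : ∀ t, ‖A' t‖ ≤ B := fun t => (hC _ (projIcc 0 T hT t).2).trans (le_max_left _ _)
  have hh : 0 < 1 / (2 * B) := by positivity
  have main : ∀ n : ℕ, ∃ y : ℝ → V, y 0 = x₀ ∧ ∀ t ∈ Icc 0 (n * (1 / (2 * B))),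
      HasDerivWithinAt y (A' t (y t)) (Icc 0 (n * (1 / (2 * B)))) t := by
    intro n
    induction n with
    | zero =>
      refine ⟨fun _ => x₀, rfl, fun t _ => ?_⟩
      simp only [Nat.cast_zero, zero_mul, Icc_self]
      exact HasFDerivWithinAt.of_subsingleton subsingleton_singleton
    | succ n ih =>
      obtain ⟨y₁, hy₁, h₁⟩ := ih
      obtain ⟨y₂, hy₂, h₂⟩ :=
        exists_linear_ode_step hA'c hB hAB (n * (1 / (2 * B))) (y₁ (n * (1 / (2 * B))))
      have e : (n : ℝ) * (1 / (2 * B)) + 1 / (2 * B) = ((n + 1 : ℕ) : ℝ) * (1 / (2 * B)) := by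
        push_cast; ring
      obtain ⟨y, hy, h⟩ := hasDerivWithinAt_glue (f := fun t x => A' t x) (by positivity)
        (by linarith) hy₂ h₁ h₂
      rw [e] at h
      exact ⟨y, hy.trans hy₁, h⟩
  obtain ⟨n, hn⟩ := exists_nat_ge (T / (1 / (2 * B)))
  obtain ⟨y, hy, h⟩ := main n
  have hn' : T ≤ n * (1 / (2 * B)) := (div_le_iff₀ hh).1 hn
  refine ⟨y, hy, fun t ht => ?_⟩
  rw [← hA'e t ht]
  exact (h t ⟨ht.1, ht.2.trans hn'⟩).mono (Icc_subset_Icc_right hn')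

end LinearODE

/-! ### Uniqueness and differentiability of the flow -/

section Flow

variable {V : Type*} [NormedAddCommGroup V] [NormedSpace ℝ V]

theorem hasDerivAt_const_mul_exp (κ C t : ℝ) :
    HasDerivAt (fun t => κ * Real.exp (C * t)) (C * (κ * Real.exp (C * t))) t := by
  have h := (((hasDerivAt_id t).const_mul C).exp).const_mul κ
  simp only [id, mul_one] at h
  exact h.congr_deriv (by ring)

/-- A vector field with a jointly continuous derivative is uniformly close to its linearization
along a curve, in a tube around the curve. -/
theorem exists_tube {F : V → ℝ → V} {D : V → ℝ → V →L[ℝ] V}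
    (hF : ∀ z t, 0 ≤ t → HasFDerivAt (fun w => F w t) (D z t) z)
    (hD : ContinuousOn (fun q : V × ℝ => D q.1 q.2) (univ ×ˢ Ici 0)) {φ : ℝ → V} {T : ℝ}
    (hφ : ContinuousOn φ (Icc 0 T)) {ε : ℝ} (hε : 0 < ε) :
    ∃ δ > 0, ∀ t ∈ Icc 0 T, ∀ x, ‖x - φ t‖ ≤ δ →
      ‖F x t - F (φ t) t - D (φ t) t (x - φ t)‖ ≤ ε * ‖x - φ t‖ := by
  rcases lt_or_ge T 0 with hT | hT
  · exact ⟨1, one_pos, fun t ht => absurd (ht.1.trans ht.2) (not_le.2 hT)⟩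
  set c : ℝ → ℝ := fun t => projIcc 0 T hT t with hc
  have hcc : Continuous c := continuous_subtype_val.comp continuous_projIcc
  have hc0 : ∀ t, 0 ≤ c t := fun t => (projIcc 0 T hT t).2.1
  have hφc : Continuous fun t => φ (c t) := hφ.domRestrict.comp continuous_projIcc
  set ψ : ℝ × V → V →L[ℝ] V := fun q => D (φ (c q.1) + q.2) (c q.1) with hψ
  have hψc : Continuous ψ := by
    have h1 : Continuous fun q : ℝ × V => ((φ (c q.1) + q.2, c q.1) : V × ℝ) :=
      ((hφc.comp continuous_fst).add continuous_snd).prodMk (hcc.comp continuous_fst)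
    exact hD.comp_continuous h1 fun q => ⟨mem_univ _, hc0 _⟩
  have hopen : IsOpen {q : ℝ × V | ‖ψ q - ψ (q.1, 0)‖ < ε} :=
    isOpen_lt (hψc.sub (hψc.comp (continuous_fst.prodMk continuous_const))).norm continuous_const
  -- Compactness of the time interval alone makes the radius uniform in t; no local compactness of
  -- the state space enters.
  obtain ⟨u, v, -, hv, hu, h0, huv⟩ := generalized_tube_lemma
    (isCompact_Icc (a := (0 : ℝ)) (b := T))
    (isCompact_singleton (x := (0 : V))) hopen (by
      rintro ⟨t, x⟩ ⟨_, hx⟩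
      simp only [mem_singleton_iff] at hx
      simp [hx, hε])
  obtain ⟨δ, hδ, hδv⟩ := Metric.isOpen_iff.1 hv 0 (h0 rfl)
  refine ⟨δ / 2, by positivity, fun t ht x hx => ?_⟩
  have hct : c t = t := by simp [hc, projIcc_of_mem hT ht]
  refine Convex.norm_image_sub_le_of_norm_hasFDerivWithin_le' (f := fun w => F w t)
    (f' := fun w => D w t) (s := Metric.closedBall (φ t) (δ / 2))
    (fun w _ => (hF w t ht.1).hasFDerivWithinAt) (fun w hw => ?_) (convex_closedBall _ _)
    (Metric.mem_closedBall_self (by positivity)) (by simpa [dist_eq_norm] using hx)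
  have hw' : w - φ t ∈ v := hδv (by
    have : ‖w - φ t‖ ≤ δ / 2 := by simpa [dist_eq_norm] using hw
    simp only [Metric.mem_ball, dist_zero_right]
    linarith)
  have := huv (show (t, w - φ t) ∈ u ×ˢ v from ⟨hu ht, hw'⟩)
  simp only [mem_ofPred_eq, hψ, hct, add_sub_cancel, add_zero] at this
  exact this.le

variable {F : V → ℝ → V} {D : V → ℝ → V →L[ℝ] V}

theorem continuousOn_of_solution {ψ : ℝ → V}
    (hψ : ∀ t, 0 ≤ t → HasDerivWithinAt ψ (F (ψ t) t) (Ici 0) t) : ContinuousOn ψ (Ici 0) :=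
  fun t ht => (hψ t ht).continuousWithinAt

/-- Solutions that start close to a given solution stay close to it on a compact interval. -/
theorem exists_solution_close
    (hF : ∀ z t, 0 ≤ t → HasFDerivAt (fun w => F w t) (D z t) z)
    (hD : ContinuousOn (fun q : V × ℝ => D q.1 q.2) (univ ×ˢ Ici 0)) {φ : ℝ → V}
    (hφ : ∀ t, 0 ≤ t → HasDerivWithinAt φ (F (φ t) t) (Ici 0) t) (T : ℝ) :
    ∃ C κ : ℝ, 0 < κ ∧ ∀ ψ : ℝ → V,
      (∀ t, 0 ≤ t → HasDerivWithinAt ψ (F (ψ t) t) (Ici 0) t) →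
      ∀ ρ, 0 < ρ → ρ ≤ κ → ‖ψ 0 - φ 0‖ ≤ ρ → ∀ t ∈ Icc 0 T,
        ‖ψ t - φ t‖ ≤ ρ * Real.exp (C * t) := by
  have hφc := (continuousOn_of_solution hφ).mono (Icc_subset_Ici_self : Icc 0 T ⊆ Ici 0)
  obtain ⟨δ, hδ, htube⟩ := exists_tube hF hD hφc one_pos
  have hDφ : ContinuousOn (fun t => D (φ t) t) (Icc 0 T) :=
    hD.comp (hφc.prodMk continuousOn_id) fun t ht => ⟨mem_univ _, ht.1⟩
  obtain ⟨B, hB⟩ := isCompact_Icc.exists_bound_of_continuousOn hDφ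
  -- The linear part accounts for `max B 0`, the tube error with ε = 1 for 1, and the remaining 1
  -- makes the barrier inequality strict.
  set C := max B 0 + 2 with hC
  have hC0 : 0 ≤ C := by positivity
  -- With ρ ≤ δ / exp(CT) the barrier stays below δ, so at a time of contact with the barrier the
  -- solution lies in the tube.
  refine ⟨C, δ / Real.exp (C * T), by positivity, fun ψ hψ ρ hρ hρκ h0 => ?_⟩
  have hψc := (continuousOn_of_solution hψ).mono (Icc_subset_Ici_self : Icc 0 T ⊆ Ici 0)
  refine fun t ht => image_norm_le_of_norm_deriv_right_lt_deriv_boundary (f := fun t => ψ t - φ t)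
    (f' := fun t => F (ψ t) t - F (φ t) t) (hψc.sub hφc)
    (fun s hs => ((hψ s hs.1).sub (hφ s hs.1)).mono (Ici_subset_Ici.2 hs.1))
    (B := fun t => ρ * Real.exp (C * t)) (B' := fun t => C * (ρ * Real.exp (C * t)))
    (by simpa using h0) (fun s => hasDerivAt_const_mul_exp ρ C s) (fun s hs hse => ?_) ht
  have hs' : s ∈ Icc 0 T := ⟨hs.1, hs.2.le⟩
  have h1 : ‖ψ s - φ s‖ ≤ δ := by
    rw [hse]
    calc ρ * Real.exp (C * s) ≤ δ / Real.exp (C * T) * Real.exp (C * T) := by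
          have : C * s ≤ C * T := mul_le_mul_of_nonneg_left hs.2.le hC0
          gcongr
      _ = δ := by field_simp
  have h2 := htube s hs' _ h1
  have h3 := ((D (φ s) s).le_opNorm (ψ s - φ s)).trans
    (mul_le_mul_of_nonneg_right ((hB s hs').trans (le_max_left B 0)) (norm_nonneg _))
  have h4 := norm_add_le (F (ψ s) s - F (φ s) s - D (φ s) s (ψ s - φ s)) (D (φ s) s (ψ s - φ s))
  rw [sub_add_cancel] at h4
  have h5 : 0 < ρ * Real.exp (C * s) := by positivity
  rw [hse] at h2 h3
  rw [hC]
  linarith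

/-- Equal initial values are within ρ of each other for every ρ > 0; let ρ → 0 in
`exists_solution_close`. -/
theorem solution_unique
    (hF : ∀ z t, 0 ≤ t → HasFDerivAt (fun w => F w t) (D z t) z)
    (hD : ContinuousOn (fun q : V × ℝ => D q.1 q.2) (univ ×ˢ Ici 0)) {φ ψ : ℝ → V}
    (hφ : ∀ t, 0 ≤ t → HasDerivWithinAt φ (F (φ t) t) (Ici 0) t)
    (hψ : ∀ t, 0 ≤ t → HasDerivWithinAt ψ (F (ψ t) t) (Ici 0) t) (h0 : ψ 0 = φ 0) {t : ℝ}
    (ht : 0 ≤ t) : ψ t = φ t := by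
  obtain ⟨C, κ, hκ, h⟩ := exists_solution_close hF hD hφ t
  have key : ∀ ρ, 0 < ρ → ρ ≤ κ → ‖ψ t - φ t‖ ≤ ρ * Real.exp (C * t) := fun ρ h1 h2 =>
    h ψ hψ ρ h1 h2 (by simp [h0, h1.le]) t ⟨ht, le_rfl⟩
  have hlim : Filter.Tendsto (fun ρ : ℝ => ρ * Real.exp (C * t)) (nhdsWithin 0 (Ioi 0)) (nhds 0) := by
    have : Continuous fun ρ : ℝ => ρ * Real.exp (C * t) := by fun_prop
    simpa using (this.tendsto 0).mono_left nhdsWithin_le_nhds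
  have hle : ‖ψ t - φ t‖ ≤ 0 := by
    refine ge_of_tendsto hlim ?_
    filter_upwards [Ioc_mem_nhdsGT hκ] with ρ hρ using key ρ hρ.1 hρ.2
  exact sub_eq_zero.1 (norm_le_zero_iff.1 hle)

/-- On a compact time interval the flow is differentiable in the initial state, with a
derivative that solves the variational equation. -/
theorem exists_hasFDerivAt_flow_Icc [CompleteSpace V]
    (hF : ∀ z t, 0 ≤ t → HasFDerivAt (fun w => F w t) (D z t) z)
    (hD : ContinuousOn (fun q : V × ℝ => D q.1 q.2) (univ ×ˢ Ici 0)) {Z : V → ℝ → V}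
    (hZ : ∀ z t, 0 ≤ t → HasDerivWithinAt (Z z) (F (Z z t) t) (Ici 0) t)
    (hZ0 : ∀ z, Z z 0 = z) (z₀ : V) {T : ℝ} (hT : 0 ≤ T) :
    ∃ Y : ℝ → V →L[ℝ] V, ∀ t ∈ Icc 0 T,
      HasDerivWithinAt Y ((D (Z z₀ t) t).comp (Y t)) (Icc 0 T) t ∧
      HasFDerivAt (fun w => Z w t) (Y t) z₀ := by
  have hφc := (continuousOn_of_solution (hZ z₀)).mono (Icc_subset_Ici_self : Icc 0 T ⊆ Ici 0)
  have hDφ : ContinuousOn (fun t => D (Z z₀ t) t) (Icc 0 T) :=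
    hD.comp (hφc.prodMk continuousOn_id) fun t ht => ⟨mem_univ _, ht.1⟩
  obtain ⟨B, hB⟩ := isCompact_Icc.exists_bound_of_continuousOn hDφ
  -- The candidate derivative is the fundamental solution, obtained from a linear equation in the
  -- space of operators whose coefficient is left composition with D.
  obtain ⟨Y, hY0, hY⟩ := exists_linear_ode hT
    (A := fun t => ContinuousLinearMap.compL ℝ V V V (D (Z z₀ t) t))
    ((ContinuousLinearMap.compL ℝ V V V).continuous.comp_continuousOn hDφ)
    (ContinuousLinearMap.id ℝ V)
  have hY' : ∀ t ∈ Icc 0 T, HasDerivWithinAt Y ((D (Z z₀ t) t).comp (Y t)) (Icc 0 T) t := hY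
  refine ⟨Y, fun t ht => ⟨hY t ht, ?_⟩⟩
  have hYv : ∀ v, ∀ s ∈ Icc 0 T, HasDerivWithinAt (fun s => Y s v) (D (Z z₀ s) s (Y s v))
      (Icc 0 T) s := fun v s hs => by
    have := (hY' s hs).clm_apply (hasDerivWithinAt_const s (Icc 0 T) v)
    simpa using this
  obtain ⟨C, κ, hκ, hclose⟩ := exists_solution_close hF hD (hZ z₀) T
  set C₂ := max B 0 + 2 with hC₂
  rw [hasFDerivAt_iff_isLittleO, Asymptotics.isLittleO_iff]
  intro ε hε
  set C₁ := max C 0 with hC₁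
  have hC₂0 : 0 ≤ C₂ := by positivity
  set M := Real.exp (C₁ * T) with hM
  have hM0 : 0 < M := Real.exp_pos _
  -- Chosen so that the final bound ε' ‖w - z₀‖ M exp(C₂ T) equals ε ‖w - z₀‖.
  set ε' := ε / (M * Real.exp (C₂ * T)) with hε'
  have hε'0 : 0 < ε' := by positivity
  obtain ⟨δ, hδ, htube⟩ := exists_tube hF hD hφc hε'0
  have hr : 0 < min κ (δ / M) := by positivity
  filter_upwards [Metric.closedBall_mem_nhds z₀ hr] with w hw
  have hwr : ‖w - z₀‖ ≤ min κ (δ / M) := by simpa [dist_eq_norm] using hw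
  rcases eq_or_ne w z₀ with rfl | hne
  · simp
  have hρ : 0 < ‖w - z₀‖ := norm_pos_iff.2 (sub_ne_zero.2 hne)
  have hcl : ∀ s ∈ Icc 0 T, ‖Z w s - Z z₀ s‖ ≤ ‖w - z₀‖ * M := fun s hs => by
    refine (hclose (Z w) (hZ w) _ hρ (hwr.trans (min_le_left _ _)) (by simp [hZ0]) s hs).trans ?_
    have : C * s ≤ C₁ * T :=
      (mul_le_mul_of_nonneg_right (le_max_left C 0) hs.1).trans
        (mul_le_mul_of_nonneg_left hs.2 (le_max_right C 0))
    exact mul_le_mul_of_nonneg_left (Real.exp_le_exp.2 this) (norm_nonneg _)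
  have hcδ : ∀ s ∈ Icc 0 T, ‖Z w s - Z z₀ s‖ ≤ δ := fun s hs => by
    refine (hcl s hs).trans ?_
    exact (le_div_iff₀ hM0).1 (hwr.trans (min_le_right _ _))
  set ρ := ε' * (‖w - z₀‖ * M) with hρdef
  have hρ0 : 0 < ρ := by positivity
  -- The remainder r = Z w - Z z₀ - Y (w - z₀) vanishes at time 0 and solves ṙ = D r + e, where e is
  -- the linearization error of the field and |e| ≤ ρ. A Grönwall barrier bounds r.
  have hest := image_norm_le_of_norm_deriv_right_lt_deriv_boundary
    (f := fun s => Z w s - Z z₀ s - Y s (w - z₀)) (a := 0) (b := T)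
    (f' := fun s => F (Z w s) s - F (Z z₀ s) s - D (Z z₀ s) s (Y s (w - z₀)))
    (B := fun s => ρ * Real.exp (C₂ * s)) (B' := fun s => C₂ * (ρ * Real.exp (C₂ * s)))
    ((((continuousOn_of_solution (hZ w)).mono Icc_subset_Ici_self).sub hφc).sub
      fun s hs => (hYv _ s hs).continuousWithinAt)
    (fun s hs => ((((hZ w s hs.1).sub (hZ z₀ s hs.1)).mono (Ici_subset_Ici.2 hs.1)).sub
      ((hYv _ s ⟨hs.1, hs.2.le⟩).mono_of_mem_nhdsWithin (Icc_mem_nhdsGE_of_mem hs))))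
    (by simp [hZ0, hY0, hρ0.le]) (fun s => hasDerivAt_const_mul_exp ρ C₂ s)
    (fun s hs hse => by
      have hs' : s ∈ Icc 0 T := ⟨hs.1, hs.2.le⟩
      have h1 := htube s hs' _ (hcδ s hs')
      have h2 : ε' * ‖Z w s - Z z₀ s‖ ≤ ρ := mul_le_mul_of_nonneg_left (hcl s hs') hε'0.le
      have h3 := ((D (Z z₀ s) s).le_opNorm (Z w s - Z z₀ s - Y s (w - z₀))).trans
        (mul_le_mul_of_nonneg_right ((hB s hs').trans (le_max_left B 0)) (norm_nonneg _))
      have h4 := norm_add_le (F (Z w s) s - F (Z z₀ s) s - D (Z z₀ s) s (Z w s - Z z₀ s))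
        (D (Z z₀ s) s (Z w s - Z z₀ s - Y s (w - z₀)))
      have h5 : F (Z w s) s - F (Z z₀ s) s - D (Z z₀ s) s (Z w s - Z z₀ s) +
          D (Z z₀ s) s (Z w s - Z z₀ s - Y s (w - z₀)) =
          F (Z w s) s - F (Z z₀ s) s - D (Z z₀ s) s (Y s (w - z₀)) := by
        rw [map_sub (D (Z z₀ s) s) (Z w s - Z z₀ s)]; abel
      rw [h5] at h4
      have h6 : ρ ≤ ρ * Real.exp (C₂ * s) :=
        le_mul_of_one_le_right hρ0.le (Real.one_le_exp (mul_nonneg hC₂0 hs.1))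
      have h7 : 0 < ρ * Real.exp (C₂ * s) := by positivity
      rw [hse] at h3
      rw [hC₂] at h3 h6 h7 ⊢
      linarith)
  refine (hest ht).trans ?_
  have h1 : C₂ * t ≤ C₂ * T := mul_le_mul_of_nonneg_left ht.2 hC₂0
  calc ρ * Real.exp (C₂ * t) ≤ ρ * Real.exp (C₂ * T) := by gcongr
    _ = ε * ‖w - z₀‖ := by rw [hρdef, hε']; field_simp

theorem differentiableAt_flow [CompleteSpace V]
    (hF : ∀ z t, 0 ≤ t → HasFDerivAt (fun w => F w t) (D z t) z)
    (hD : ContinuousOn (fun q : V × ℝ => D q.1 q.2) (univ ×ˢ Ici 0)) {Z : V → ℝ → V}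
    (hZ : ∀ z t, 0 ≤ t → HasDerivWithinAt (Z z) (F (Z z t) t) (Ici 0) t)
    (hZ0 : ∀ z, Z z 0 = z) (z₀ : V) {t : ℝ} (ht : 0 ≤ t) :
    DifferentiableAt ℝ (fun w => Z w t) z₀ := by
  obtain ⟨Y, hY⟩ := exists_hasFDerivAt_flow_Icc hF hD hZ hZ0 z₀ ht
  exact (hY t ⟨ht, le_rfl⟩).2.differentiableAt

/-- The variational equation. -/
theorem hasDerivWithinAt_fderiv_flow [CompleteSpace V]
    (hF : ∀ z t, 0 ≤ t → HasFDerivAt (fun w => F w t) (D z t) z)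
    (hD : ContinuousOn (fun q : V × ℝ => D q.1 q.2) (univ ×ˢ Ici 0)) {Z : V → ℝ → V}
    (hZ : ∀ z t, 0 ≤ t → HasDerivWithinAt (Z z) (F (Z z t) t) (Ici 0) t)
    (hZ0 : ∀ z, Z z 0 = z) (z₀ v : V) {t : ℝ} (ht : 0 ≤ t) :
    HasDerivWithinAt (fun s => fderiv ℝ (fun w => Z w s) z₀ v)
      (D (Z z₀ t) t (fderiv ℝ (fun w => Z w t) z₀ v)) (Ici 0) t := by
  -- The horizon t + 1 makes [0, t + 1] a neighbourhood of t within [0, ∞).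
  obtain ⟨Y, hY⟩ := exists_hasFDerivAt_flow_Icc hF hD hZ hZ0 z₀ (by linarith : 0 ≤ t + 1)
  have ht' : t ∈ Icc 0 (t + 1) := ⟨ht, by linarith⟩
  have h1 := (hY t ht').1.clm_apply (hasDerivWithinAt_const t (Icc 0 (t + 1)) v)
  have h2 : HasDerivWithinAt (fun s => fderiv ℝ (fun w => Z w s) z₀ v)
      (D (Z z₀ t) t (fderiv ℝ (fun w => Z w t) z₀ v)) (Icc 0 (t + 1)) t := by
    rw [(hY t ht').2.fderiv]
    refine HasDerivWithinAt.congr ?_ (fun s hs => by rw [(hY s hs).2.fderiv])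
      (by rw [(hY t ht').2.fderiv])
    simpa using h1
  refine h2.mono_of_mem_nhdsWithin (mem_nhdsWithin.2 ⟨Iio (t + 1), isOpen_Iio, ?_, ?_⟩)
  · exact lt_add_one t
  · exact fun s hs => ⟨hs.2, hs.1.le⟩

end Flow

/-! ### First exit times and lengths of paths -/

section Calculus

/-- Finitely many functions stay positive if, as long as all of them are nonnegative, each of
them increases where it vanishes. -/
theorem pos_of_deriv_pos_of_eq_zero {ι : Type*} [Finite ι] {ψ ψ' : ι → ℝ → ℝ} {a b : ℝ}
    (hd : ∀ i, ∀ t ∈ Icc a b, HasDerivWithinAt (ψ i) (ψ' i t) (Icc a b) t)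
    (ha : ∀ i, 0 < ψ i a)
    (h : ∀ t ∈ Ioc a b, (∀ k, 0 ≤ ψ k t) → ∀ i, ψ i t = 0 → 0 < ψ' i t) :
    ∀ t ∈ Icc a b, ∀ i, 0 < ψ i t := by
  by_contra! hcon
  obtain ⟨t₂, ht₂, i₂, hi₂⟩ := hcon
  have hc : ∀ i, ContinuousOn (ψ i) (Icc a b) := fun i t ht => (hd i t ht).continuousWithinAt
  -- The times at which positivity fails form a compact set, because the index set is finite; its
  -- least element is the first failure.
  set S : Set ℝ := ⋃ i, Icc a b ∩ ψ i ⁻¹' Iic 0 with hS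
  have hSc : IsCompact S :=
    isCompact_iUnion fun i => isCompact_Icc.of_isClosed_subset
      ((hc i).preimage_isClosed_of_isClosed isClosed_Icc isClosed_Iic) inter_subset_left
  obtain ⟨t₁, ht₁, hmin⟩ := hSc.exists_isLeast ⟨t₂, mem_iUnion.2 ⟨i₂, ht₂, hi₂⟩⟩
  obtain ⟨i, ht₁I, hi⟩ := mem_iUnion.1 ht₁
  have hi : ψ i t₁ ≤ 0 := hi
  have hlt : a < t₁ := lt_of_le_of_ne ht₁I.1 fun e => by
    rw [← e] at hi; exact absurd (ha i) (not_lt.2 hi)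
  have hbefore : ∀ k, ∀ s ∈ Ico a t₁, 0 < ψ k s := fun k s hs => by
    by_contra! hk
    exact absurd (hmin (mem_iUnion.2 ⟨k, ⟨hs.1, hs.2.le.trans ht₁I.2⟩, hk⟩)) (not_le.2 hs.2)
  have hsub : Ico a t₁ ⊆ Icc a b := fun s hs => ⟨hs.1, hs.2.le.trans ht₁I.2⟩
  have : (nhdsWithin t₁ (Ico a t₁)).NeBot := by
    rw [nhdsWithin_Ico_eq_nhdsLT hlt]; infer_instance
  have hnn : ∀ k, 0 ≤ ψ k t₁ := fun k =>
    ge_of_tendsto ((hc k t₁ ht₁I).mono hsub)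
      (eventually_nhdsWithin_of_forall fun s hs => (hbefore k s hs).le)
  have hzero : ψ i t₁ = 0 := le_antisymm hi (hnn i)
  have hpos := h t₁ ⟨hlt, ht₁I.2⟩ hnn i hzero
  -- `ψ i` is positive before t₁ and zero there, so its slopes from the left are nonpositive,
  -- against the positive derivative.
  have hsl := (hasDerivWithinAt_iff_tendsto_slope' (by simp)).1 ((hd i t₁ ht₁I).mono hsub)
  refine absurd hpos (not_lt.2 (le_of_tendsto hsl (eventually_nhdsWithin_of_forall fun s hs => ?_)))
  rw [slope_def_field, hzero, sub_zero]
  exact div_nonpos_of_nonneg_of_nonpos (hbefore i s hs).le (by linarith [hs.2])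

/-- The distance of the end points of a differentiable path is at most its length. -/
theorem edist_le_lintegral_of_hasDerivAt {E : Type*} [NormedAddCommGroup E] [NormedSpace ℝ E]
    [CompleteSpace E] {g g' : ℝ → E} (hg : ∀ s, HasDerivAt g (g' s) s) :
    edist (g 0) (g 1) ≤ ∫⁻ s in Icc (0 : ℝ) 1, ‖g' s‖ₑ := by
  have hg' : g' = deriv g := funext fun s => (hg s).deriv.symm
  -- An infinite length gives nothing to prove; a finite one makes the derivative integrable, so the
  -- fundamental theorem applies without continuity of g'.
  by_cases hfin : ∫⁻ s in Icc (0 : ℝ) 1, ‖g' s‖ₑ = ⊤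
  · rw [hfin]; exact le_top
  have hmeas : MeasureTheory.AEStronglyMeasurable g'
      (MeasureTheory.volume.restrict (Icc (0 : ℝ) 1)) := by
    rw [hg']
    exact aestronglyMeasurable_deriv g _
  have hint : MeasureTheory.IntegrableOn g' (Icc (0 : ℝ) 1) :=
    ⟨hmeas, lt_top_iff_ne_top.2 hfin⟩
  have hint' : IntervalIntegrable g' MeasureTheory.volume 0 1 :=
    (intervalIntegrable_iff_integrableOn_Icc_of_le zero_le_one).2 hint
  have hftc := intervalIntegral.integral_eq_sub_of_hasDerivAt (fun s _ => hg s) hint'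
  rw [edist_comm, edist_eq_enorm_sub, ← hftc,
    intervalIntegral.integral_of_le zero_le_one, ← MeasureTheory.integral_Icc_eq_integral_Ioc]
  exact MeasureTheory.enorm_integral_le_lintegral_enorm _

end Calculus

end Contraction

namespace Contraction

/-! ### Quadratic forms and the largest eigenvalue of Hermitian parts -/

section HermitianParts

variable {N : ℕ}

/-- The skew-Hermitian part of A contributes only an imaginary number to the quadratic form. -/
theorem re_inner_hermPart (A : Matrix (Fin N) (Fin N) ℂ) (v : CPos N) :
    (inner ℂ v (Matrix.toEuclideanCLM (𝕜 := ℂ) (hermPart A) v)).re =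
      (inner ℂ v (Matrix.toEuclideanCLM (𝕜 := ℂ) A v)).re := by
  have h1 : Matrix.toEuclideanCLM (𝕜 := ℂ) (hermPart A) =
      (1 / 2 : ℂ) • (Matrix.toEuclideanCLM (𝕜 := ℂ) A +
        ContinuousLinearMap.adjoint (Matrix.toEuclideanCLM (𝕜 := ℂ) A)) := by
    rw [hermPart, map_smul, map_add, ← Matrix.star_eq_conjTranspose, map_star,
      ContinuousLinearMap.star_eq_adjoint]
  rw [h1, smul_apply, inner_smul_right, add_apply, inner_add_right,
    ContinuousLinearMap.adjoint_inner_right]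
  have h2 : (inner ℂ (Matrix.toEuclideanCLM (𝕜 := ℂ) A v) v).re =
      (inner ℂ v (Matrix.toEuclideanCLM (𝕜 := ℂ) A v)).re := inner_re_symm (𝕜 := ℂ) _ _
  simp only [one_div, Complex.mul_re, Complex.add_re, h2, Complex.inv_re, Complex.inv_im]
  norm_num
  ring

/-- The Rayleigh bound for a Hermitian matrix. -/
theorem re_inner_le_of_eigenvalues_le {H : Matrix (Fin N) (Fin N) ℂ} (hH : H.IsHermitian) {l : ℝ}
    (hl : ∀ i, hH.eigenvalues i ≤ l) (v : CPos N) :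
    (inner ℂ v (Matrix.toEuclideanCLM (𝕜 := ℂ) H v)).re ≤ l * ‖v‖ ^ 2 := by
  -- In an orthonormal eigenbasis the form is the sum of the eigenvalues weighted by |⟨b_i, v⟩|²,
  -- and these weights add up to |v|².
  set b := hH.eigenvectorBasis with hb
  have hHb : ∀ i, Matrix.toEuclideanCLM (𝕜 := ℂ) H (b i) = (hH.eigenvalues i : ℂ) • b i := by
    intro i
    ext k
    have := congrFun (hH.mulVec_eigenvectorBasis i) k
    simpa using this
  have hadj : ContinuousLinearMap.adjoint (Matrix.toEuclideanCLM (𝕜 := ℂ) H) =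
      Matrix.toEuclideanCLM (𝕜 := ℂ) H := by
    rw [← ContinuousLinearMap.star_eq_adjoint, ← map_star, Matrix.star_eq_conjTranspose, hH.eq]
  have hterm : ∀ i, inner ℂ v (b i) * inner ℂ (b i) (Matrix.toEuclideanCLM (𝕜 := ℂ) H v) =
      ((hH.eigenvalues i * ‖(inner ℂ (b i) v : ℂ)‖ ^ 2 : ℝ) : ℂ) := by
    intro i
    rw [← hadj, ContinuousLinearMap.adjoint_inner_right, hHb, inner_smul_left,
      ← inner_conj_symm v (b i)]
    push_cast
    rw [← Complex.conj_mul']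
    simp
    ring
  have hterm' : ∀ i, inner ℂ v (b i) * inner ℂ (b i) v =
      ((‖(inner ℂ (b i) v : ℂ)‖ ^ 2 : ℝ) : ℂ) := by
    intro i
    rw [← inner_conj_symm v (b i), Complex.conj_mul']
    push_cast
    rfl
  have h1 : ‖v‖ ^ 2 = ∑ i, ‖(inner ℂ (b i) v : ℂ)‖ ^ 2 := by
    have h := b.sum_inner_mul_inner v v
    simp_rw [hterm'] at h
    rw [inner_self_eq_norm_sq_to_K] at h
    have h' := congrArg Complex.re h
    rw [← Complex.ofReal_sum, Complex.ofReal_re] at h'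
    rw [h']
    norm_cast
  rw [← b.sum_inner_mul_inner]
  simp_rw [hterm]
  rw [← Complex.ofReal_sum, Complex.ofReal_re, h1, Finset.mul_sum]
  exact Finset.sum_le_sum fun i _ => mul_le_mul_of_nonneg_right (hl i) (sq_nonneg _)

theorem exists_unit_eigenvector {H : Matrix (Fin N) (Fin N) ℂ} (hH : H.IsHermitian) (i : Fin N) :
    ∃ v : CPos N, ‖v‖ = 1 ∧
      (inner ℂ v (Matrix.toEuclideanCLM (𝕜 := ℂ) H v)).re = hH.eigenvalues i := by
  have hHb : Matrix.toEuclideanCLM (𝕜 := ℂ) H (hH.eigenvectorBasis i) =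
      (hH.eigenvalues i : ℂ) • hH.eigenvectorBasis i := by
    ext k
    have := congrFun (hH.mulVec_eigenvectorBasis i) k
    simpa using this
  have hn : ‖hH.eigenvectorBasis i‖ = 1 := hH.eigenvectorBasis.orthonormal.1 i
  refine ⟨_, hn, ?_⟩
  rw [hHb, inner_smul_right, inner_self_eq_norm_sq_to_K, hn]
  simp

variable {ι : Type*} [Fintype ι]

/-- The largest eigenvalue of the Hermitian parts of a family of matrices. -/
def maxEigenvalue (A : ι → Matrix (Fin N) (Fin N) ℂ) : ℝ :=
  ⨆ q : ι × Fin N, (hermPart_isHermitian (A q.1)).eigenvalues q.2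

theorem re_inner_le_maxEigenvalue (A : ι → Matrix (Fin N) (Fin N) ℂ) (j : ι) (v : CPos N) :
    (inner ℂ v (Matrix.toEuclideanCLM (𝕜 := ℂ) (A j) v)).re ≤ maxEigenvalue A * ‖v‖ ^ 2 := by
  rw [← re_inner_hermPart]
  exact re_inner_le_of_eigenvalues_le (hermPart_isHermitian (A j)) (fun i =>
    le_ciSup (f := fun q : ι × Fin N => (hermPart_isHermitian (A q.1)).eigenvalues q.2)
      (Set.finite_range _).bddAbove (j, i)) v

/-- An eigenvalue for A is the value of its form at a unit eigenvector; there the form of B is at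
most its largest eigenvalue and that of A - B at most its operator norm. -/
theorem maxEigenvalue_le_add (A B : ι → Matrix (Fin N) (Fin N) ℂ) :
    maxEigenvalue A ≤ maxEigenvalue B + ∑ j, ‖Matrix.toEuclideanCLM (𝕜 := ℂ) (A j - B j)‖ := by
  rcases isEmpty_or_nonempty (ι × Fin N) with hE | hE
  · have h0 : ∀ C : ι → Matrix (Fin N) (Fin N) ℂ, maxEigenvalue C = 0 := fun C =>
      Real.iSup_of_isEmpty _
    rw [h0, h0, zero_add]
    exact Finset.sum_nonneg fun _ _ => norm_nonneg _
  refine ciSup_le fun q => ?_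
  obtain ⟨v, hv, he⟩ := exists_unit_eigenvector (hermPart_isHermitian (A q.1)) q.2
  rw [← he, re_inner_hermPart]
  have h1 := re_inner_le_maxEigenvalue B q.1 v
  rw [hv] at h1
  have h2 : (inner ℂ v (Matrix.toEuclideanCLM (𝕜 := ℂ) (A q.1 - B q.1) v)).re ≤
      ‖Matrix.toEuclideanCLM (𝕜 := ℂ) (A q.1 - B q.1)‖ := by
    refine (Complex.re_le_norm _).trans ((norm_inner_le_norm _ _).trans ?_)
    have := (Matrix.toEuclideanCLM (𝕜 := ℂ) (A q.1 - B q.1)).le_opNorm v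
    rw [hv] at this ⊢
    linarith
  have h3 := Finset.single_le_sum (f := fun j => ‖Matrix.toEuclideanCLM (𝕜 := ℂ) (A j - B j)‖)
    (fun _ _ => norm_nonneg _) (Finset.mem_univ q.1)
  have h4 : (inner ℂ v (Matrix.toEuclideanCLM (𝕜 := ℂ) (A q.1) v)).re =
      (inner ℂ v (Matrix.toEuclideanCLM (𝕜 := ℂ) (B q.1) v)).re +
      (inner ℂ v (Matrix.toEuclideanCLM (𝕜 := ℂ) (A q.1 - B q.1) v)).re := by
    rw [map_sub, sub_apply, inner_sub_right]
    simp
  linarith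

theorem continuous_toEuclideanCLM :
    Continuous fun A : Matrix (Fin N) (Fin N) ℂ => Matrix.toEuclideanCLM (𝕜 := ℂ) A := by
  refine continuous_clm_apply.2 fun v => ?_
  have : Continuous fun A : Matrix (Fin N) (Fin N) ℂ => A.mulVec v.ofLp :=
    continuous_id.matrix_mulVec continuous_const
  exact (PiLp.continuous_toLp 2 _).comp this

/-- The estimate `maxEigenvalue_le_add`, used in both directions, gives continuity without tracking
individual eigenvalues. It makes ∫(η + λ_max) differentiable along trajectories. -/
theorem continuousOn_maxEigenvalue {X : Type*} [TopologicalSpace X] {s : Set X}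
    {A : X → ι → Matrix (Fin N) (Fin N) ℂ} (hA : ∀ j, ContinuousOn (fun x => A x j) s) :
    ContinuousOn (fun x => maxEigenvalue (A x)) s := by
  intro x₀ hx₀
  have hlim : Filter.Tendsto
      (fun x => ∑ j, ‖Matrix.toEuclideanCLM (𝕜 := ℂ) (A x j - A x₀ j)‖)
      (nhdsWithin x₀ s) (nhds 0) := by
    have h : ContinuousWithinAt
        (fun x => ∑ j, ‖Matrix.toEuclideanCLM (𝕜 := ℂ) (A x j - A x₀ j)‖) s x₀ :=
      (continuousOn_finsetSum _ fun j _ => (continuous_toEuclideanCLM.comp_continuousOn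
        ((hA j).sub continuousOn_const)).norm) x₀ hx₀
    simpa [ContinuousWithinAt] using h
  refine tendsto_iff_norm_sub_tendsto_zero.2 (squeeze_zero (fun _ => norm_nonneg _) (fun x => ?_)
    hlim)
  rw [Real.norm_eq_abs, abs_sub_le_iff]
  have h1 := maxEigenvalue_le_add (A x) (A x₀)
  have h2 := maxEigenvalue_le_add (A x₀) (A x)
  have h3 : ∀ j, ‖Matrix.toEuclideanCLM (𝕜 := ℂ) (A x₀ j - A x j)‖ =
      ‖Matrix.toEuclideanCLM (𝕜 := ℂ) (A x j - A x₀ j)‖ := fun j => by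
    rw [← neg_sub, map_neg, norm_neg]
  simp_rw [h3] at h2
  exact ⟨by linarith, by linarith⟩

end HermitianParts

/-! ### Real parts and the spaces of the modal coordinates -/

section RealPart

variable {N : ℕ}

/-- The real part of a complex vector, regarded as a complex vector. -/
def reMap (N : ℕ) : CPos N →L[ℝ] CPos N :=
  LinearMap.toContinuousLinearMap
    { toFun := fun v => ofPos (rePos v)
      map_add' := fun v w => by ext i; simp [ofPos, rePos]
      map_smul' := fun r v => by ext i; simp [ofPos, rePos] }

theorem reMap_apply (v : CPos N) : reMap N v = ofPos (rePos v) := rfl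

theorem norm_reMap_le (v : CPos N) : ‖reMap N v‖ ≤ ‖v‖ := by
  rw [reMap_apply, EuclideanSpace.norm_eq, EuclideanSpace.norm_eq]
  refine Real.sqrt_le_sqrt (Finset.sum_le_sum fun i _ => ?_)
  have : ‖((v i).re : ℂ)‖ ≤ ‖v i‖ := by
    rw [Complex.norm_real]; exact Complex.abs_re_le_norm (v i)
  exact pow_le_pow_left₀ (norm_nonneg _) this 2

theorem norm_rePos_sub_le (v w : CPos N) : ‖rePos v - rePos w‖ ≤ ‖v - w‖ := by
  rw [EuclideanSpace.norm_eq, EuclideanSpace.norm_eq]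
  refine Real.sqrt_le_sqrt (Finset.sum_le_sum fun i _ => ?_)
  have : ‖(rePos v - rePos w) i‖ ≤ ‖(v - w) i‖ := by
    have h : (rePos v - rePos w) i = ((v - w) i).re := by simp [rePos]
    rw [h]; exact Complex.abs_re_le_norm _
  exact pow_le_pow_left₀ (norm_nonneg _) this 2

theorem reMap_mem (b : Bool) (v : CPos N) : reMap N v ∈ levelSubspace N b := by
  intro _ i
  simp [reMap_apply, ofPos]

/-- Any projection serves: the right-hand sides already lie in the subspace, and projecting only
changes their type, so that they form a vector field on `State`. -/
theorem exists_levelProj (N : ℕ) (b : Bool) :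
    ∃ P : CPos N →L[ℝ] Level N b, ∀ x : Level N b, P x = x :=
  Submodule.ClosedComplemented.of_finiteDimensional (levelSubspace N b)

/-- A linear projection onto the space of a modal coordinate. -/
def levelProj (N : ℕ) (b : Bool) : CPos N →L[ℝ] Level N b :=
  (exists_levelProj N b).choose

theorem levelProj_coe {b : Bool} (x : Level N b) : levelProj N b x = x :=
  (exists_levelProj N b).choose_spec x

theorem coe_levelProj {b : Bool} {x : CPos N} (hx : x ∈ levelSubspace N b) :
    (levelProj N b x : CPos N) = x := by
  rw [levelProj_coe ⟨x, hx⟩]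

/-- The derivative of a map into the space of a modal coordinate takes values in this space. -/
theorem fderiv_mem_level {E : Type*} [NormedAddCommGroup E] [NormedSpace ℝ E] {b : Bool}
    {g : E → CPos N} {g' : E →L[ℝ] CPos N} {x : E} (hg : HasFDerivAt g g' x)
    (h : ∀ y, g y ∈ levelSubspace N b) (v : E) : g' v ∈ levelSubspace N b := by
  have h1 := ((levelSubspace N b).subtypeL.comp (levelProj N b)).hasFDerivAt.comp x hg
  have h2 : ((levelSubspace N b).subtypeL.comp (levelProj N b)) ∘ g = g := by
    funext y
    exact coe_levelProj (h y)
  rw [h2] at h1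
  rw [hg.unique h1]
  exact (levelProj N b (g' v)).2

end RealPart

end Contraction

namespace Contraction

/-! ### Partial derivatives on finite products -/

section Pi

variable {ι : Type*} [Fintype ι] {E : ι → Type*} [∀ i, NormedAddCommGroup (E i)]
  [∀ i, NormedSpace ℝ (E i)] {G : Type*} [NormedAddCommGroup G] [NormedSpace ℝ G]

theorem hasFDerivAt_comp_proj_add {i : ι} {g : E i → G} {g' : E i →L[ℝ] G} {z : ∀ i, E i}
    {f : (∀ i, E i) → G} {f' : (∀ i, E i) →L[ℝ] G} (hg : HasFDerivAt g g' (z i))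
    (hf : HasFDerivAt f f' z) :
    HasFDerivAt (fun w : ∀ i, E i => g (w i) + f w)
      (g'.comp (ContinuousLinearMap.proj (R := ℝ) (φ := E) i) + f') z :=
  (hg.comp z (ContinuousLinearMap.proj (R := ℝ) (φ := E) i).hasFDerivAt).add hf

theorem fderiv_comp_update [DecidableEq ι] {f : (∀ i, E i) → G} {z : ∀ i, E i}
    (hf : DifferentiableAt ℝ f z) (i : ι) :
    fderiv ℝ (fun w => f (Function.update z i w)) (z i) =
      (fderiv ℝ f z).comp (ContinuousLinearMap.single ℝ E i) := by
  have h1 : HasFDerivAt f (fderiv ℝ f z) (Function.update z i (z i)) := by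
    rw [Function.update_eq_self]
    exact hf.hasFDerivAt
  refine (h1.comp (z i) (hasFDerivAt_update z (z i))).fderiv.trans (congrArg _ ?_)
  ext x k
  rcases eq_or_ne k i with rfl | h
  · simp
  · simp [h]

/-- Splitting v into its coordinates is what brings in the norms |∂d/∂z_k| one by one. -/
theorem norm_clm_apply_le_sum [DecidableEq ι] (L : (∀ i, E i) →L[ℝ] G) (v : ∀ i, E i) :
    ‖L v‖ ≤ ∑ i, ‖L.comp (ContinuousLinearMap.single ℝ E i)‖ * ‖v i‖ := by
  have h : v = ∑ i, ContinuousLinearMap.single ℝ E i (v i) := by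
    simp only [ContinuousLinearMap.single_apply]
    exact (Finset.univ_sum_single v).symm
  conv_lhs => rw [h, map_sum]
  exact norm_sum_le_of_le _ fun i _ =>
    (L.comp (ContinuousLinearMap.single ℝ E i)).le_opNorm (v i)

end Pi

/-! ### The distorted characteristic equation as a vector field, and its variational equation -/

namespace DistortedSystem

variable {N p : ℕ} (S : DistortedSystem N p)

/-- The right-hand side of the distorted characteristic equation as a vector field. -/
def field (z : State N p S.cplx) (t : ℝ) : State N p S.cplx :=
  fun j => levelProj N (S.cplx j) (S.prim j (z j) t + S.drive z t j)

/-- The derivative of what drives the `j`-th equation. -/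
def driveDeriv (z : State N p S.cplx) (t : ℝ) (j : Fin p) : State N p S.cplx →L[ℝ] CPos N :=
  if h : (j : ℕ) + 1 < p then
    (reMap N).comp ((levelSubspace N (S.cplx ⟨(j : ℕ) + 1, h⟩)).subtypeL.comp
      (ContinuousLinearMap.proj (R := ℝ) (φ := fun j => Level N (S.cplx j)) ⟨(j : ℕ) + 1, h⟩))
  else fderiv ℝ (fun w => S.dist w t) z

/-- The derivative of the `j`-th component of the right-hand side. -/
def coordDeriv (z : State N p S.cplx) (t : ℝ) (j : Fin p) : State N p S.cplx →L[ℝ] CPos N :=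
  (levelMap (S.cplx j) (S.rate j (z j) t)).comp
    (ContinuousLinearMap.proj (R := ℝ) (φ := fun j => Level N (S.cplx j)) j) + S.driveDeriv z t j

/-- The derivative of the vector field. -/
def fieldDeriv (z : State N p S.cplx) (t : ℝ) : State N p S.cplx →L[ℝ] State N p S.cplx :=
  ContinuousLinearMap.pi fun j => (levelProj N (S.cplx j)).comp (S.coordDeriv z t j)

theorem drive_mem (z : State N p S.cplx) (t : ℝ) (j : Fin p) :
    S.drive z t j ∈ levelSubspace N (S.cplx j) := by
  unfold drive
  split_ifs with h
  · exact reMap_mem _ _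
  · exact S.dist_mem j (by omega) z t

theorem hasFDerivAt_drive (z : State N p S.cplx) {t : ℝ} (ht : 0 ≤ t) (j : Fin p) :
    HasFDerivAt (fun w => S.drive w t j) (S.driveDeriv z t j) z := by
  unfold drive driveDeriv
  split_ifs with h
  · exact ((reMap N).comp ((levelSubspace N (S.cplx ⟨(j : ℕ) + 1, h⟩)).subtypeL.comp
      (ContinuousLinearMap.proj (R := ℝ) (φ := fun j => Level N (S.cplx j))
        ⟨(j : ℕ) + 1, h⟩))).hasFDerivAt
  · exact (S.differentiable_dist t ht z).hasFDerivAt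

theorem hasFDerivAt_coord (z : State N p S.cplx) {t : ℝ} (ht : 0 ≤ t) (j : Fin p) :
    HasFDerivAt (fun w : State N p S.cplx => S.prim j (w j) t + S.drive w t j)
      (S.coordDeriv z t j) z := by
  exact hasFDerivAt_comp_proj_add (E := fun j => Level N (S.cplx j))
    (S.hasFDerivAt_prim j (z j) t ht) (S.hasFDerivAt_drive z ht j)

theorem hasFDerivAt_field (z : State N p S.cplx) (t : ℝ) (ht : 0 ≤ t) :
    HasFDerivAt (fun w => S.field w t) (S.fieldDeriv z t) z :=
  hasFDerivAt_pi.2 fun j => (levelProj N (S.cplx j)).hasFDerivAt.comp z (S.hasFDerivAt_coord z ht j)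

/-- The projection in `fieldDeriv` drops out, since the derivative of a map into a subspace stays in
that subspace. -/
theorem coe_fieldDeriv_apply (z : State N p S.cplx) {t : ℝ} (ht : 0 ≤ t) (v : State N p S.cplx)
    (j : Fin p) :
    (S.fieldDeriv z t v j : CPos N) =
      Matrix.toEuclideanCLM (𝕜 := ℂ) (S.rate j (z j) t) (v j) + S.driveDeriv z t j v := by
  have h := coe_levelProj (fderiv_mem_level (S.hasFDerivAt_coord z ht j)
    (fun w => Submodule.add_mem _ (S.prim_mem j _ t) (S.drive_mem w t j)) v)
  exact h

theorem continuousOn_fieldDeriv :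
    ContinuousOn (fun q : State N p S.cplx × ℝ => S.fieldDeriv q.1 q.2) (univ ×ˢ Ici 0) := by
  -- The state space is finite-dimensional, so continuity in operator norm may be tested on single
  -- vectors.
  refine (@continuousOn_clm_apply ℝ _ (State N p S.cplx) Pi.normedAddCommGroup Pi.normedSpace
    (State N p S.cplx) Pi.normedAddCommGroup Pi.normedSpace _ _ _ _ _ _).2 fun v =>
    continuousOn_pi.2 fun j => ?_
  refine (levelProj N (S.cplx j)).continuous.comp_continuousOn (ContinuousOn.add ?_ ?_)
  · have h1 : ContinuousOn (fun q : State N p S.cplx × ℝ => S.rate j (q.1 j) q.2)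
        (univ ×ˢ Ici 0) :=
      (S.continuousOn_rate j).comp (f := fun q : State N p S.cplx × ℝ => (q.1 j, q.2))
        (by fun_prop) fun q hq => ⟨mem_univ _, hq.2⟩
    exact (continuous_toEuclideanCLM.comp_continuousOn h1).clm_apply continuousOn_const
  · unfold driveDeriv
    split_ifs with h
    · exact continuousOn_const
    · exact S.continuousOn_fderiv_dist.clm_apply continuousOn_const

variable {S}

theorem IsSolution.hasDerivWithinAt {z : ℝ → State N p S.cplx} (hz : S.IsSolution z) (t : ℝ)
    (ht : 0 ≤ t) : HasDerivWithinAt z (S.field (z t) t) (Ici 0) t := by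
  refine hasDerivWithinAt_pi.2 fun j => ?_
  have h := (levelProj N (S.cplx j)).hasFDerivAt.comp_hasDerivWithinAt t (hz t ht j)
  refine h.congr_deriv rfl |>.congr (fun s _ => ?_) ?_
  · exact (levelProj_coe _).symm
  · exact (levelProj_coe _).symm

/-- `IsDistortedForm` only supplies some solution z with Re z_1 = x; uniqueness places it on the
flow, where the contraction estimates hold. -/
theorem IsSolution.eq_flow {z : ℝ → State N p S.cplx} (hz : S.IsSolution z)
    {Z : State N p S.cplx → ℝ → State N p S.cplx} (hZ : S.IsFlow Z) {t : ℝ} (ht : 0 ≤ t) :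
    z t = Z (z 0) t :=
  @solution_unique (State N p S.cplx) Pi.normedAddCommGroup Pi.normedSpace S.field S.fieldDeriv
    S.hasFDerivAt_field S.continuousOn_fieldDeriv _ _ (hZ (z 0)).1.hasDerivWithinAt
    hz.hasDerivWithinAt (hZ (z 0)).2.symm t ht

theorem IsFlow.differentiable {Z : State N p S.cplx → ℝ → State N p S.cplx} (hZ : S.IsFlow Z)
    {t : ℝ} (ht : 0 ≤ t) : Differentiable ℝ fun w => Z w t := fun z₀ =>
  @differentiableAt_flow (State N p S.cplx) Pi.normedAddCommGroup Pi.normedSpace S.field S.fieldDeriv _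
    S.hasFDerivAt_field S.continuousOn_fieldDeriv Z
    (fun z => (hZ z).1.hasDerivWithinAt) (fun z => (hZ z).2) z₀ t ht

theorem IsFlow.continuousOn {Z : State N p S.cplx → ℝ → State N p S.cplx} (hZ : S.IsFlow Z)
    (z₀ : State N p S.cplx) : ContinuousOn (Z z₀) (Ici 0) :=
  @continuousOn_of_solution (State N p S.cplx) Pi.normedAddCommGroup Pi.normedSpace S.field _
    (hZ z₀).1.hasDerivWithinAt

theorem IsFlow.virtualDisplacement_zero {Z : State N p S.cplx → ℝ → State N p S.cplx}
    (hZ : S.IsFlow Z) (z₀ v : State N p S.cplx) : virtualDisplacement Z z₀ v 0 = v := by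
  have : (fun w => Z w 0) = id := funext fun w => (hZ w).2
  rw [virtualDisplacement, this, fderiv_id]
  rfl

theorem IsFlow.hasDerivWithinAt_virtualDisplacement
    {Z : State N p S.cplx → ℝ → State N p S.cplx} (hZ : S.IsFlow Z) (z₀ v : State N p S.cplx)
    {t : ℝ} (ht : 0 ≤ t) (j : Fin p) :
    HasDerivWithinAt (fun s => (virtualDisplacement Z z₀ v s j : CPos N))
      (Matrix.toEuclideanCLM (𝕜 := ℂ) (S.rate j (Z z₀ t j) t)
        (virtualDisplacement Z z₀ v t j) + S.driveDeriv (Z z₀ t) t j (virtualDisplacement Z z₀ v t))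
      (Ici 0) t := by
  have h := @hasDerivWithinAt_fderiv_flow (State N p S.cplx) Pi.normedAddCommGroup Pi.normedSpace S.field
    S.fieldDeriv _ S.hasFDerivAt_field S.continuousOn_fieldDeriv Z
    (fun z => (hZ z).1.hasDerivWithinAt) (fun z => (hZ z).2) z₀ v t ht
  have h2 := (levelSubspace N (S.cplx j)).subtypeL.hasFDerivAt.comp_hasDerivWithinAt t
    (hasDerivWithinAt_pi.1 h j)
  refine h2.congr_deriv ?_
  exact S.coe_fieldDeriv_apply (Z z₀ t) ht _ j

variable (S)

theorem normPartial_eq (z : State N p S.cplx) {t : ℝ} (ht : 0 ≤ t) (j : Fin p) :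
    S.normPartial z t j = ‖(fderiv ℝ (fun w => S.dist w t) z).comp
      (ContinuousLinearMap.single ℝ (fun j => Level N (S.cplx j)) j)‖ := by
  rw [normPartial]
  exact congrArg norm (fderiv_comp_update (E := fun j => Level N (S.cplx j))
    (S.differentiable_dist t ht z) j)

theorem norm_fderiv_dist_apply_le (z : State N p S.cplx) {t : ℝ} (ht : 0 ≤ t)
    (v : State N p S.cplx) :
    ‖fderiv ℝ (fun w => S.dist w t) z v‖ ≤ ∑ j, S.normPartial z t j * ‖v j‖ := by
  simp_rw [S.normPartial_eq z ht]
  exact norm_clm_apply_le_sum (E := fun j => Level N (S.cplx j)) _ v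

theorem normPartial_nonneg (z : State N p S.cplx) (t : ℝ) (j : Fin p) :
    0 ≤ S.normPartial z t j := by
  rw [normPartial]
  exact norm_nonneg (E := Level N (S.cplx j) →L[ℝ] CPos N) _

variable {S}

theorem continuousOn_normPartial {z : ℝ → State N p S.cplx} (hz : ContinuousOn z (Ici 0))
    (j : Fin p) : ContinuousOn (fun t => S.normPartial (z t) t j) (Ici 0) := by
  have h1 : ContinuousOn (fun t => fderiv ℝ (fun w => S.dist w t) (z t)) (Ici 0) :=
    S.continuousOn_fderiv_dist.comp (hz.prodMk continuousOn_id) fun t ht => ⟨mem_univ _, ht⟩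
  exact (h1.clm_comp continuousOn_const).norm.congr fun t ht => S.normPartial_eq (z t) ht j

theorem continuousOn_lamMax {z : ℝ → State N p S.cplx} (hz : ContinuousOn z (Ici 0)) :
    ContinuousOn (fun t => S.lamMax (z t) t) (Ici 0) :=
  continuousOn_maxEigenvalue (A := fun t j => S.rate j (z t j) t) fun j =>
    (S.continuousOn_rate j).comp (f := fun t => (z t j, t))
      (((continuous_apply j).comp_continuousOn hz).prodMk continuousOn_id)
      fun _ ht => ⟨mem_univ _, ht⟩

theorem re_inner_rate_le (z : State N p S.cplx) (t : ℝ) (j : Fin p) (v : CPos N) :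
    (inner ℂ v (Matrix.toEuclideanCLM (𝕜 := ℂ) (S.rate j (z j) t) v)).re ≤
      S.lamMax z t * ‖v‖ ^ 2 :=
  re_inner_le_maxEigenvalue (fun j => S.rate j (z j) t) j v

end DistortedSystem

end Contraction

namespace Contraction

/-! ### Comparison with a supersolution, and the iterates L^j η -/

section Comparison

/-- Comparison of the norms in a coupled system of differential equations with a majorant that
solves the corresponding scalar differential inequalities. -/
theorem norm_le_of_coupled_deriv_le {ι : Type*} [Fintype ι] {N : ℕ} {a b C : ℝ}
    {y y' : ι → ℝ → CPos N} {W W' : ι → ℝ → ℝ} {l : ℝ → ℝ} {c : ι → ι → ℝ → ℝ}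
    (hy : ∀ j, ∀ t ∈ Icc a b, HasDerivWithinAt (y j) (y' j t) (Icc a b) t)
    (hW : ∀ j, ∀ t ∈ Icc a b, HasDerivWithinAt (W j) (W' j t) (Icc a b) t)
    (hW0 : ∀ j, ∀ t ∈ Icc a b, 0 ≤ W j t) (hc : ∀ j k t, 0 ≤ c j k t)
    (hC : ∀ j, ∀ t ∈ Icc a b, l t + ∑ k, c j k t ≤ C)
    (hyl : ∀ j, ∀ t ∈ Icc a b, (inner ℂ (y j t) (y' j t)).re ≤
      l t * ‖y j t‖ ^ 2 + ‖y j t‖ * ∑ k, c j k t * ‖y k t‖)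
    (hWl : ∀ j, ∀ t ∈ Icc a b, l t * W j t + ∑ k, c j k t * W k t ≤ W' j t)
    (ha : ∀ j, ‖y j a‖ ≤ W j a) {t : ℝ} (ht : t ∈ Icc a b) (j : ι) : ‖y j t‖ ≤ W j t := by
  -- Adding e = ε exp((C+1)t) to every majorant makes the inequalities strict: its derivative (C+1)e
  -- exceeds (l + Σ_k c_jk) e ≤ C e.
  have main : ∀ ε, 0 < ε → ‖y j t‖ ≤ W j t + ε * Real.exp ((C + 1) * t) := by
    intro ε hε
    set e : ℝ → ℝ := fun t => ε * Real.exp ((C + 1) * t) with he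
    have he0 : ∀ t, 0 < e t := fun t => by positivity
    set V : ι → ℝ → ℝ := fun j t => W j t + e t with hV
    have hV0 : ∀ j, ∀ t ∈ Icc a b, 0 < V j t := fun j t ht => add_pos_of_nonneg_of_pos (hW0 j t ht) (he0 t)
    have hVd : ∀ j, ∀ t ∈ Icc a b,
        HasDerivWithinAt (V j) (W' j t + (C + 1) * e t) (Icc a b) t := fun j t ht =>
      (hW j t ht).add (hasDerivAt_const_mul_exp ε (C + 1) t).hasDerivWithinAt
    -- Squares are compared because the norm need not be differentiable where y vanishes.
    have hnd : ∀ j, ∀ t ∈ Icc a b, HasDerivWithinAt (fun t => ‖y j t‖ ^ 2)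
        (2 * (inner ℂ (y j t) (y' j t)).re) (Icc a b) t := fun j t ht => by
      have h1 := Complex.reCLM.hasFDerivAt.comp_hasDerivWithinAt t ((hy j t ht).inner ℂ (hy j t ht))
      refine (h1.congr_deriv ?_).congr (fun s _ => ?_) ?_
      · have : (inner ℂ (y' j t) (y j t)).re = (inner ℂ (y j t) (y' j t)).re :=
          inner_re_symm (𝕜 := ℂ) _ _
        simp only [Complex.reCLM_apply, Complex.add_re, this]
        ring
      · exact (inner_self_eq_norm_sq (𝕜 := ℂ) (y j s)).symm
      · exact (inner_self_eq_norm_sq (𝕜 := ℂ) (y j t)).symm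
    have hpos := pos_of_deriv_pos_of_eq_zero (ψ := fun j t => V j t ^ 2 - ‖y j t‖ ^ 2)
      (ψ' := fun j t => 2 * V j t * (W' j t + (C + 1) * e t) - 2 * (inner ℂ (y j t) (y' j t)).re)
      (a := a) (b := b)
      (fun j t ht => (((hVd j t ht).pow 2).congr_deriv (by norm_num)).sub (hnd j t ht))
      (fun j => by
        have h1 : ‖y j a‖ < V j a := lt_add_of_le_of_pos (ha j) (he0 a)
        have := pow_lt_pow_left₀ h1 (norm_nonneg _) two_ne_zero
        linarith)
      (fun s hs hnn i hi => by
        have hs' : s ∈ Icc a b := Ioc_subset_Icc_self hs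
        have hle : ∀ k, ‖y k s‖ ≤ V k s := fun k =>
          le_of_sq_le_sq (by linarith [hnn k]) (hV0 k s hs').le
        -- At contact the i-th norm equals its majorant while the others are at most theirs;
        -- nonnegative couplings then force the difference of squares to increase.
        have heq : ‖y i s‖ = V i s :=
          le_antisymm (hle i) (le_of_sq_le_sq (by linarith) (norm_nonneg _))
        have h1 := hyl i s hs'
        have h2 : ∑ k, c i k s * ‖y k s‖ ≤ ∑ k, c i k s * V k s :=
          Finset.sum_le_sum fun k _ => mul_le_mul_of_nonneg_left (hle k) (hc i k s)
        have h3 : ∑ k, c i k s * V k s = ∑ k, c i k s * W k s + (∑ k, c i k s) * e s := by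
          simp only [hV, mul_add, Finset.sum_add_distrib, Finset.sum_mul]
        have h4 := hWl i s hs'
        have h5 := mul_le_mul_of_nonneg_right (hC i s hs') (he0 s).le
        have h6 : l s * V i s + ∑ k, c i k s * V k s < W' i s + (C + 1) * e s := by
          have hVi : V i s = W i s + e s := rfl
          rw [h3, hVi]
          nlinarith [he0 s]
        have h7 : V i s * (l s * V i s + ∑ k, c i k s * V k s) <
            V i s * (W' i s + (C + 1) * e s) := mul_lt_mul_of_pos_left h6 (hV0 i s hs')
        rw [heq] at h1
        have h8 := mul_le_mul_of_nonneg_left h2 (hV0 i s hs').le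
        nlinarith) t ht j
    exact (le_of_sq_le_sq (by linarith) (hV0 j t ht).le)
  refine le_of_forall_pos_le_add fun δ hδ => ?_
  have h := main (δ / Real.exp ((C + 1) * t)) (by positivity)
  rwa [div_mul_cancel₀ _ (Real.exp_pos _).ne'] at h

theorem hasDerivWithinAt_exp_integral {φ : ℝ → ℝ} (hφ : ContinuousOn φ (Ici 0)) {t₀ b t : ℝ}
    (h0 : 0 ≤ t₀) (ht : t ∈ Icc t₀ b) :
    HasDerivWithinAt (fun t => Real.exp (∫ τ in t₀..t, φ τ))
      (φ t * Real.exp (∫ τ in t₀..t, φ τ)) (Icc t₀ b) t := by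
  -- Extending φ by its value at 0 gives a continuous function on ℝ with the same integrals over
  -- [t₀, s], as t₀ ≥ 0.
  have hc : Continuous fun t => φ (max t 0) :=
    hφ.comp_continuous (continuous_id.max continuous_const) fun t => le_max_right t 0
  have heq : ∀ s ∈ Icc t₀ b, ∫ τ in t₀..s, φ τ = ∫ τ in t₀..s, φ (max τ 0) := fun s hs => by
    refine intervalIntegral.integral_congr fun τ hτ => ?_
    rw [uIcc_of_le hs.1] at hτ
    simp only [max_eq_left (h0.trans hτ.1)]
  have h1 := (intervalIntegral.integral_hasDerivAt_right (hc.intervalIntegrable t₀ t)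
    (hc.stronglyMeasurableAtFilter _ _) hc.continuousAt).exp.hasDerivWithinAt (s := Icc t₀ b)
  refine (h1.congr_deriv ?_).congr (fun s hs => by rw [heq s hs]) (by rw [heq t ht])
  rw [heq t ht, max_eq_left (h0.trans ht.1), mul_comm]

/-- Each application of L costs one derivative, except the first: L^0 is constant and L^1 h = h.
Hence p - 1 derivatives of h suffice up to L^p h. -/
theorem contDiffOn_iterL {h : ℝ → ℝ} {p : ℕ}
    (hh : ContDiffOn ℝ ((p - 1 : ℕ) : WithTop ℕ∞) h (Ici 0)) :
    ∀ j k : ℕ, j + k ≤ p → ContDiffOn ℝ (k : WithTop ℕ∞) (iterL h j) (Ici 0) := by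
  intro j
  induction j with
  | zero => exact fun k _ => contDiffOn_const
  | succ j ih =>
    intro k hk
    have h1 := ih (k + 1) (by omega)
    have h2 : ContDiffOn ℝ (k : WithTop ℕ∞) h (Ici 0) :=
      hh.of_le (by exact_mod_cast (by omega : k ≤ p - 1))
    exact (h1.derivWithin (uniqueDiffOn_Ici 0) (by norm_cast)).add
      (h2.mul (h1.of_le (by exact_mod_cast Nat.le_succ k)))

theorem hasDerivWithinAt_iterL {h : ℝ → ℝ} {p : ℕ}
    (hh : ContDiffOn ℝ ((p - 1 : ℕ) : WithTop ℕ∞) h (Ici 0)) {j : ℕ} (hj : j < p) {t : ℝ}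
    (ht : 0 ≤ t) :
    HasDerivWithinAt (iterL h j) (iterL h (j + 1) t - h t * iterL h j t) (Ici 0) t := by
  have h1 := contDiffOn_iterL hh j 1 hj
  refine ((h1.differentiableOn (by norm_num)) t ht).hasDerivWithinAt.congr_deriv ?_
  simp [iterL]

end Comparison

/-! ### Finite distances from virtual displacements -/

section Length

variable {ι : Type*} [Fintype ι] {E : ι → Type*} [∀ i, NormedAddCommGroup (E i)]
  [∀ i, NormedSpace ℝ (E i)]

theorem edist_le_lintegral_fderiv_comp {Φ : (∀ i, E i) → ∀ i, E i} (hΦ : Differentiable ℝ Φ)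
    {γ : ℝ → ∀ i, E i} (hγ : Differentiable ℝ γ) (i : ι) [CompleteSpace (E i)] :
    edist (Φ (γ 0) i) (Φ (γ 1) i) ≤
      ∫⁻ s in Icc (0 : ℝ) 1, ‖fderiv ℝ Φ (γ s) (deriv γ s) i‖ₑ :=
  edist_le_lintegral_of_hasDerivAt (g := fun s => Φ (γ s) i) fun s =>
    hasDerivAt_pi.1 ((hΦ (γ s)).hasFDerivAt.comp_hasDerivAt s (hγ s).hasDerivAt) i

/-- Along the segment from z₀ to z₁ the velocity is constantly z₁ - z₀, so the length of its image
is at most B. -/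
theorem norm_sub_le_of_norm_fderiv_apply_le {Φ : (∀ i, E i) → ∀ i, E i}
    (hΦ : Differentiable ℝ Φ) (z₀ z₁ : ∀ i, E i) (i : ι) [CompleteSpace (E i)] {B : ℝ}
    (hB : ∀ z, ‖fderiv ℝ Φ z (z₁ - z₀) i‖ ≤ B) : ‖Φ z₀ i - Φ z₁ i‖ ≤ B := by
  have hγ : ∀ s : ℝ, HasDerivAt (fun s : ℝ => z₀ + s • (z₁ - z₀)) (z₁ - z₀) s := fun s => by
    simpa using ((hasDerivAt_id s).smul_const (z₁ - z₀)).const_add z₀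
  have h := edist_le_lintegral_fderiv_comp hΦ (fun s => (hγ s).differentiableAt) i
  simp only [zero_smul, add_zero, one_smul, add_sub_cancel] at h
  have h2 : ∫⁻ s in Icc (0 : ℝ) 1, ‖fderiv ℝ Φ (z₀ + s • (z₁ - z₀))
      (deriv (fun s : ℝ => z₀ + s • (z₁ - z₀)) s) i‖ₑ ≤ ENNReal.ofReal B := by
    calc _ ≤ ∫⁻ _ in Icc (0 : ℝ) 1, ENNReal.ofReal B := by
          refine MeasureTheory.lintegral_mono fun s => ?_
          simp only [(hγ s).deriv]
          rw [← ofReal_norm]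
          exact ENNReal.ofReal_le_ofReal (hB _)
      _ = ENNReal.ofReal B := by simp
  have h3 := h.trans h2
  rw [edist_dist, dist_eq_norm] at h3
  exact (ENNReal.ofReal_le_ofReal_iff ((norm_nonneg _).trans (hB z₀))).1 h3

end Length

end Contraction

namespace Contraction

/-! ### Contraction of virtual displacements and of trajectories -/

section Contraction

variable {N p : ℕ} {S : DistortedSystem N p} {Z : State N p S.cplx → ℝ → State N p S.cplx}
  {η : State N p S.cplx → ℝ → ℝ}

theorem growth_pos (z₀ : State N p S.cplx) (t₀ t : ℝ) : 0 < growth S Z η z₀ t₀ t :=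
  Real.exp_pos _

theorem continuousOn_rate_along (hZ : S.IsFlow Z) (hη : IsDistortionBound S Z η)
    (z₀ : State N p S.cplx) :
    ContinuousOn (fun t => along Z η z₀ t + along Z S.lamMax z₀ t) (Ici 0) :=
  (hη z₀).1.continuousOn.add (DistortedSystem.continuousOn_lamMax (hZ.continuousOn z₀))

/-- The weights with which the components of a virtual displacement drive the `j`-th one. -/
def couplingWeight (S : DistortedSystem N p) (z : State N p S.cplx) (t : ℝ) (j k : Fin p) : ℝ :=
  if (j : ℕ) + 1 < p then (if (k : ℕ) = j + 1 then 1 else 0) else S.normPartial z t k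

theorem couplingWeight_nonneg (z : State N p S.cplx) (t : ℝ) (j k : Fin p) :
    0 ≤ couplingWeight S z t j k := by
  unfold couplingWeight
  split_ifs
  · exact zero_le_one
  · exact le_rfl
  · exact S.normPartial_nonneg z t k

theorem sum_couplingWeight_of_lt (z : State N p S.cplx) (t : ℝ) {j : Fin p}
    (h : (j : ℕ) + 1 < p) (u : Fin p → ℝ) :
    ∑ k, couplingWeight S z t j k * u k = u ⟨(j : ℕ) + 1, h⟩ := by
  rw [Finset.sum_eq_single (⟨(j : ℕ) + 1, h⟩ : Fin p)]
  · simp [couplingWeight, h]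
  · intro k _ hk
    have : (k : ℕ) ≠ j + 1 := fun e => hk (Fin.ext e)
    simp [couplingWeight, h, this]
  · simp

theorem sum_couplingWeight_of_not_lt (z : State N p S.cplx) (t : ℝ) {j : Fin p}
    (h : ¬ (j : ℕ) + 1 < p) (u : Fin p → ℝ) :
    ∑ k, couplingWeight S z t j k * u k = ∑ k, S.normPartial z t k * u k := by
  simp [couplingWeight, h]

theorem norm_driveDeriv_le (z : State N p S.cplx) {t : ℝ} (ht : 0 ≤ t) (j : Fin p)
    (v : State N p S.cplx) :
    ‖S.driveDeriv z t j v‖ ≤ ∑ k, couplingWeight S z t j k * ‖v k‖ := by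
  by_cases h : (j : ℕ) + 1 < p
  · rw [sum_couplingWeight_of_lt z t h fun k => ‖v k‖, DistortedSystem.driveDeriv, dif_pos h]
    exact norm_reMap_le _
  · rw [sum_couplingWeight_of_not_lt z t h fun k => ‖v k‖, DistortedSystem.driveDeriv, dif_neg h]
    exact S.norm_fderiv_dist_apply_le z ht v

theorem continuousOn_couplingWeight (hZ : S.IsFlow Z) (z₀ : State N p S.cplx) (j k : Fin p) :
    ContinuousOn (fun t => couplingWeight S (Z z₀ t) t j k) (Ici 0) := by
  unfold couplingWeight
  split_ifs
  · exact continuousOn_const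
  · exact continuousOn_const
  · exact DistortedSystem.continuousOn_normPartial (hZ.continuousOn z₀) k

/-- Equality in all rows but the last, where this is the hypothesis on L^p η. It is the
supersolution property of the majorant. -/
theorem sum_couplingWeight_iterL_le (hη : IsDistortionBound S Z η) (z₀ : State N p S.cplx)
    {t : ℝ} (ht : 0 ≤ t) (j : Fin p) :
    ∑ k, couplingWeight S (Z z₀ t) t j k * iterL (along Z η z₀) k t ≤
      iterL (along Z η z₀) (j + 1) t := by
  by_cases h : (j : ℕ) + 1 < p
  · rw [sum_couplingWeight_of_lt _ t h fun k => iterL (along Z η z₀) k t]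
  · rw [sum_couplingWeight_of_not_lt _ t h fun k => iterL (along Z η z₀) k t,
      (by omega : (j : ℕ) + 1 = p)]
    exact ((hη z₀).2 t ht).2

/-- Virtual displacements contract with the rates `Λ_j + η`. -/
theorem norm_virtualDisplacement_le (hZ : S.IsFlow Z) (hη : IsDistortionBound S Z η)
    (z₀ v : State N p S.cplx) {t₀ K : ℝ} (h0 : 0 ≤ t₀) (hK : 0 ≤ K)
    (h : ∀ j : Fin p, ‖virtualDisplacement Z z₀ v t₀ j‖ ≤ K * iterL (along Z η z₀) j t₀)
    {t : ℝ} (ht : t₀ ≤ t) (j : Fin p) :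
    ‖virtualDisplacement Z z₀ v t j‖ ≤
      K * iterL (along Z η z₀) j t * growth S Z η z₀ t₀ t := by
  set L : ℕ → ℝ → ℝ := iterL (along Z η z₀) with hL
  set G : ℝ → ℝ := growth S Z η z₀ t₀ with hG
  set l : ℝ → ℝ := along Z S.lamMax z₀ with hl
  set c : Fin p → Fin p → ℝ → ℝ := fun j k t => couplingWeight S (Z z₀ t) t j k with hc
  have hsub : Icc t₀ t ⊆ Ici 0 := fun s hs => h0.trans hs.1
  have hlc : ContinuousOn l (Ici 0) := DistortedSystem.continuousOn_lamMax (hZ.continuousOn z₀)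
  -- Summing over all rows gives one constant C for every j, since the weights are nonnegative.
  have hcont : ContinuousOn (fun s => l s + ∑ j, ∑ k, c j k s) (Icc t₀ t) :=
    (hlc.add (continuousOn_finsetSum _ fun j _ => continuousOn_finsetSum _ fun k _ =>
      continuousOn_couplingWeight hZ z₀ j k)).mono hsub
  obtain ⟨C, hC⟩ := isCompact_Icc.exists_bound_of_continuousOn hcont
  have hc0 : ∀ j k s, 0 ≤ c j k s := fun j k s => couplingWeight_nonneg _ _ _ _
  have hGd : ∀ s ∈ Icc t₀ t, HasDerivWithinAt G ((along Z η z₀ s + l s) * G s) (Icc t₀ t) s :=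
    fun s hs => hasDerivWithinAt_exp_integral (continuousOn_rate_along hZ hη z₀) h0 hs
  have hG0 : ∀ s, 0 < G s := growth_pos z₀ t₀
  refine norm_le_of_coupled_deriv_le (a := t₀) (b := t) (C := C) (l := l) (c := c)
    (y := fun j s => (virtualDisplacement Z z₀ v s j : CPos N))
    (W := fun j s => K * L j s * G s)
    (fun j s hs => (hZ.hasDerivWithinAt_virtualDisplacement z₀ v (hsub hs) j).mono hsub)
    (fun j s hs => (((hasDerivWithinAt_iterL (hη z₀).1 j.2 (hsub hs)).mono hsub).const_mul K).mul
      (hGd s hs))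
    (fun j s hs => ?_) hc0 (fun j s hs => ?_) (fun j s hs => ?_) (fun j s hs => ?_)
    (fun j => ?_) ⟨ht, le_rfl⟩ j
  · exact mul_nonneg (mul_nonneg hK (((hη z₀).2 s (hsub hs)).1 j j.2.le)) (hG0 s).le
  · have h1 := (le_abs_self _).trans (hC s hs)
    have h2 := Finset.single_le_sum (f := fun j => ∑ k, c j k s)
      (fun j _ => Finset.sum_nonneg fun k _ => hc0 j k s) (Finset.mem_univ j)
    linarith
  · rw [inner_add_right, Complex.add_re]
    have h1 := DistortedSystem.re_inner_rate_le (Z z₀ s) s j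
      (virtualDisplacement Z z₀ v s j : CPos N)
    have h2 := (Complex.re_le_norm _).trans (norm_inner_le_norm (𝕜 := ℂ)
      (virtualDisplacement Z z₀ v s j : CPos N)
      (S.driveDeriv (Z z₀ s) s j (virtualDisplacement Z z₀ v s)))
    have h3 := mul_le_mul_of_nonneg_left
      (norm_driveDeriv_le (Z z₀ s) (hsub hs) j (virtualDisplacement Z z₀ v s))
      (norm_nonneg (virtualDisplacement Z z₀ v s j : CPos N))
    exact add_le_add h1 (h2.trans h3)
  · have h1 := sum_couplingWeight_iterL_le hη z₀ (hsub hs) j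
    have h2 : ∑ k, c j k s * (K * L k s * G s) = (K * G s) * ∑ k, c j k s * L k s := by
      rw [Finset.mul_sum]
      exact Finset.sum_congr rfl fun k _ => by ring
    have h3 := mul_le_mul_of_nonneg_left h1 (mul_nonneg hK (hG0 s).le)
    rw [h2]
    change (K * G s) * ∑ k, c j k s * L k s ≤ (K * G s) * L (j + 1) s at h3
    -- The η from the recursion cancels the η in the growth factor, leaving λ_max and the next
    -- iterate.
    have h4 : K * (L (j + 1) s - along Z η z₀ s * L j s) * G s +
        K * L j s * ((along Z η z₀ s + l s) * G s) =
        l s * (K * L j s * G s) + (K * G s) * L (j + 1) s := by ring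
    rw [h4]
    exact add_le_add le_rfl h3
  · have h1 : G t₀ = 1 := by simp [hG, growth]
    rw [h1, mul_one]
    exact h j

theorem norm_virtualDisplacement_zero_le (hZ : S.IsFlow Z) (z₀ v : State N p S.cplx)
    {u : Fin p → ℝ} {m : ℝ} (hm : 0 < m) (hu : ∀ j, m ≤ u j) (j : Fin p) :
    ‖virtualDisplacement Z z₀ v 0 j‖ ≤ (∑ k, ‖v k‖) / m * u j := by
  rw [hZ.virtualDisplacement_zero]
  have h1 : ‖v j‖ ≤ ∑ k, ‖v k‖ :=
    Finset.single_le_sum (f := fun k => ‖v k‖) (fun _ _ => norm_nonneg _) (Finset.mem_univ j)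
  have h2 : 0 ≤ (∑ k, ‖v k‖) / m :=
    div_nonneg (Finset.sum_nonneg fun _ _ => norm_nonneg _) hm.le
  calc ‖v j‖ ≤ (∑ k, ‖v k‖) / m * m := by rwa [div_mul_cancel₀ _ hm.ne']
    _ ≤ _ := mul_le_mul_of_nonneg_left (hu j) h2

theorem exists_pos_le_of_forall_pos {u : Fin p → ℝ} (hu : ∀ j, 0 < u j) :
    ∃ m > 0, ∀ j, m ≤ u j := by
  rcases isEmpty_or_nonempty (Fin p) with h | h
  · exact ⟨1, one_pos, fun j => h.elim j⟩
  · obtain ⟨i, hi⟩ := Finite.exists_min u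
    exact ⟨u i, hu i, hi⟩

theorem growth_le (hZ : S.IsFlow Z) (hη : IsDistortionBound S Z η) (z₀ : State N p S.cplx)
    {β : ℝ} (hβ : ∀ t, 0 ≤ t → along Z η z₀ t + along Z S.lamMax z₀ t ≤ β) {t : ℝ}
    (ht : 0 ≤ t) : growth S Z η z₀ 0 t ≤ Real.exp (β * t) := by
  refine Real.exp_le_exp.2 ?_
  have hc : ContinuousOn (fun t => along Z η z₀ t + along Z S.lamMax z₀ t) (uIcc 0 t) := by
    rw [uIcc_of_le ht]
    exact (continuousOn_rate_along hZ hη z₀).mono Icc_subset_Ici_self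
  have h := intervalIntegral.integral_mono_on (μ := MeasureTheory.volume) ht hc.intervalIntegrable
    (intervalIntegrable_const (c := β)) fun s hs => hβ s hs.1
  simpa [mul_comm] using h

/-- The distance of two trajectories under uniform bounds on the rates. -/
theorem norm_sub_le_of_rate_le (hZ : S.IsFlow Z) (hη : IsDistortionBound S Z η) {β m : ℝ}
    (hm : 0 < m) (hmL : ∀ z₀, ∀ j : Fin p, m ≤ iterL (along Z η z₀) j 0)
    (hβ : ∀ z₀ t, 0 ≤ t → along Z η z₀ t + along Z S.lamMax z₀ t ≤ β)
    (z₀ z₁ : State N p S.cplx) {t : ℝ} (ht : 0 ≤ t) (j : Fin p) {M : ℝ}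
    (hM : ∀ z, iterL (along Z η z) j t ≤ M) :
    ‖Z z₀ t j - Z z₁ t j‖ ≤ (∑ k, ‖(z₁ - z₀) k‖) / m * M * Real.exp (β * t) := by
  have hK : 0 ≤ (∑ k, ‖(z₁ - z₀) k‖) / m :=
    div_nonneg (Finset.sum_nonneg fun _ _ => norm_nonneg _) hm.le
  refine norm_sub_le_of_norm_fderiv_apply_le (E := fun j => Level N (S.cplx j))
    (hZ.differentiable ht) z₀ z₁ j fun z => ?_
  have h0 : 0 ≤ iterL (along Z η z) j t := ((hη z).2 t ht).1 j j.2.le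
  refine (norm_virtualDisplacement_le hZ hη z (z₁ - z₀) le_rfl hK
    (norm_virtualDisplacement_zero_le hZ z _ hm (hmL z)) ht j).trans ?_
  exact mul_le_mul (mul_le_mul_of_nonneg_left (hM z) hK) (growth_le hZ hη z (hβ z) ht)
    (growth_pos _ _ _).le (mul_nonneg hK (h0.trans (hM z)))

theorem exists_virtualDisplacement_bound (hZ : S.IsFlow Z) (hη : IsDistortionBound S Z η)
    {z₀ : State N p S.cplx} (hpos : ∀ j : Fin p, 0 < iterL (along Z η z₀) j 0)
    (v : State N p S.cplx) :
    ∃ K : ℝ, 0 < K ∧ ∀ t, 0 ≤ t → ∀ j : Fin p, ‖virtualDisplacement Z z₀ v t j‖ ≤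
      K * iterL (along Z η z₀) j t * growth S Z η z₀ 0 t := by
  obtain ⟨m, hm, hmL⟩ := exists_pos_le_of_forall_pos hpos
  have hK : 0 ≤ (∑ k, ‖v k‖) / m :=
    div_nonneg (Finset.sum_nonneg fun _ _ => norm_nonneg _) hm.le
  -- The summand 1 keeps K positive when v = 0.
  refine ⟨(∑ k, ‖v k‖) / m + 1, by linarith, fun t ht j =>
    norm_virtualDisplacement_le hZ hη z₀ v le_rfl (by linarith) (fun i => ?_) ht j⟩
  refine (norm_virtualDisplacement_zero_le hZ z₀ v hm hmL i).trans ?_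
  exact mul_le_mul_of_nonneg_right (by linarith) (hpos i).le

theorem exists_virtualDisplacement_bound_initial (hZ : S.IsFlow Z)
    (hη : IsDistortionBound S Z η) {z₀ : State N p S.cplx}
    (hpos : ∀ j : Fin p, 0 < iterL (along Z η z₀) j 0) (v : State N p S.cplx)
    (hbdd : ∀ j : Fin p, BddAbove (iterL (along Z η z₀) j '' Ici 0)) :
    ∃ K : ℝ, 0 < K ∧ ∀ t, 0 ≤ t → ∀ j : Fin p, ‖virtualDisplacement Z z₀ v t j‖ ≤
      K * iterL (along Z η z₀) j 0 * growth S Z η z₀ 0 t := by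
  obtain ⟨K, hK, h⟩ := exists_virtualDisplacement_bound hZ hη hpos v
  obtain ⟨m, hm, hmL⟩ := exists_pos_le_of_forall_pos hpos
  choose M hM using hbdd
  have hM' : ∀ j : Fin p, ∀ t, 0 ≤ t → iterL (along Z η z₀) j t ≤ M j := fun j t ht =>
    hM j (mem_image_of_mem _ ht)
  have hM0 : ∀ j : Fin p, 0 ≤ M j := fun j => (hpos j).le.trans (hM' j 0 le_rfl)
  have hR : 0 ≤ (∑ j, M j) / m := div_nonneg (Finset.sum_nonneg fun j _ => hM0 j) hm.le
  refine ⟨K * ((∑ j, M j) / m + 1), by positivity, fun t ht j => (h t ht j).trans ?_⟩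
  refine mul_le_mul_of_nonneg_right ?_ (growth_pos _ _ _).le
  rw [mul_assoc]
  refine mul_le_mul_of_nonneg_left ?_ hK.le
  -- The value at time t is traded for the one at time 0 through the common lower bound m of the
  -- initial values.
  calc iterL (along Z η z₀) j t ≤ M j := hM' j t ht
    _ ≤ ∑ j, M j := Finset.single_le_sum (fun j _ => hM0 j) (Finset.mem_univ j)
    _ = (∑ j, M j) / m * m := by rw [div_mul_cancel₀ _ hm.ne']
    _ ≤ ((∑ j, M j) / m + 1) * iterL (along Z η z₀) j 0 :=
      mul_le_mul (by linarith) (hmL j) hm.le (by linarith)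

end Contraction

end Contraction

end

theorem theorem5 {N n p : ℕ} [NeZero p]
    (f : (Fin n → Contraction.Pos N) → ℝ → Contraction.Pos N)
    (S : Contraction.DistortedSystem N p)
    (hform : Contraction.IsDistortedForm n f S)
    (Z : Contraction.State N p S.cplx → ℝ → Contraction.State N p S.cplx)
    (hZ : S.IsFlow Z)
    (η : Contraction.State N p S.cplx → ℝ → ℝ)
    (hη : Contraction.IsDistortionBound S Z η) :
    -- the virtual displacements and the integral of the rate `η + λ_max` are well defined
    (∀ t, 0 ≤ t → Differentiable ℝ fun w => Z w t) ∧
    (∀ z₀, ContinuousOn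
      (fun t => Contraction.along Z η z₀ t + Contraction.along Z S.lamMax z₀ t) (Set.Ici 0)) ∧
    -- virtual displacements contract with the rate `η + λ_max`, from every time `t₀` on
    (∀ z₀ v, ∀ t₀ K : ℝ, 0 ≤ t₀ → 0 ≤ K →
      (∀ j : Fin p, ‖Contraction.virtualDisplacement Z z₀ v t₀ j‖ ≤
        K * Contraction.iterL (Contraction.along Z η z₀) j t₀) →
      ∀ t, t₀ ≤ t → ∀ j : Fin p, ‖Contraction.virtualDisplacement Z z₀ v t j‖ ≤
        K * Contraction.iterL (Contraction.along Z η z₀) j t *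
          Contraction.growth S Z η z₀ t₀ t) ∧
    -- a constant `K` exists if the `L^{j-1} η` are positive at time `0`, and the overshoot
    -- is bounded through their values at time `0` if, moreover, they are bounded
    (∀ z₀, (∀ j : Fin p, 0 < Contraction.iterL (Contraction.along Z η z₀) j 0) → ∀ v,
      (∃ K : ℝ, 0 < K ∧ ∀ t, 0 ≤ t → ∀ j : Fin p,
        ‖Contraction.virtualDisplacement Z z₀ v t j‖ ≤
          K * Contraction.iterL (Contraction.along Z η z₀) j t *
            Contraction.growth S Z η z₀ 0 t) ∧
      ((∀ j : Fin p,
          BddAbove (Contraction.iterL (Contraction.along Z η z₀) j '' Set.Ici 0)) →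
        ∃ K : ℝ, 0 < K ∧ ∀ t, 0 ≤ t → ∀ j : Fin p,
          ‖Contraction.virtualDisplacement Z z₀ v t j‖ ≤
            K * Contraction.iterL (Contraction.along Z η z₀) j 0 *
              Contraction.growth S Z η z₀ 0 t)) ∧
    -- finite distances between arbitrary trajectories
    (∀ γ : ℝ → Contraction.State N p S.cplx, ContDiff ℝ 1 γ →
      (∀ t, 0 ≤ t → ∀ j : Fin p,
        edist (Z (γ 0) t j) (Z (γ 1) t j) ≤ Contraction.transportedLength Z γ t j) ∧
      (∀ K : ℝ → ℝ, ∀ t₀, 0 ≤ t₀ →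
        (∀ s ∈ Set.Icc (0 : ℝ) 1, 0 ≤ K s ∧ ∀ j : Fin p,
          ‖Contraction.virtualDisplacement Z (γ s) (deriv γ s) t₀ j‖ ≤
            K s * Contraction.iterL (Contraction.along Z η (γ s)) j t₀) →
        ∀ t, t₀ ≤ t → ∀ j : Fin p, Contraction.transportedLength Z γ t j ≤
          ∫⁻ s in Set.Icc (0 : ℝ) 1, ENNReal.ofReal
            (K s * Contraction.iterL (Contraction.along Z η (γ s)) j t *
              Contraction.growth S Z η (γ s) t₀ t))) ∧
    -- uniform bounds on the rates: exponential convergence of all trajectories to each other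
    (∀ β m : ℝ, 0 < m →
      (∀ z₀, ∀ j : Fin p, m ≤ Contraction.iterL (Contraction.along Z η z₀) j 0) →
      (∀ z₀ t, 0 ≤ t → Contraction.along Z η z₀ t + Contraction.along Z S.lamMax z₀ t ≤ β) →
      (∀ x y, Contraction.IsNthOrderSolution n f x → Contraction.IsNthOrderSolution n f y →
        ∃ C : ℝ, ∀ t, 0 ≤ t → ‖x t - y t‖ ≤ C * Real.exp (β * t)) ∧
      (∀ M : ℝ,
        (∀ z₀ t, 0 ≤ t → ∀ j : Fin p,
          Contraction.iterL (Contraction.along Z η z₀) j t ≤ M) →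
        ∀ z₀ z₁, ∃ C : ℝ, ∀ t, 0 ≤ t → ∀ j : Fin p,
          ‖Z z₀ t j - Z z₁ t j‖ ≤ C * Real.exp (β * t))) := by
  open Contraction in
  refine ⟨fun t ht => hZ.differentiable ht, continuousOn_rate_along hZ hη,
    fun z₀ v t₀ K h0 hK h t ht j => norm_virtualDisplacement_le hZ hη z₀ v h0 hK h ht j,
    fun z₀ hpos v => ⟨exists_virtualDisplacement_bound hZ hη hpos v,
      exists_virtualDisplacement_bound_initial hZ hη hpos v⟩,
    fun γ hγ => ⟨fun t ht j => ?_, fun K t₀ h0 h t ht j => ?_⟩,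
    fun β m hm hmL hβ => ⟨fun x y hx hy => ?_, fun M hM z₀ z₁ => ?_⟩⟩
  · exact edist_le_lintegral_fderiv_comp (E := fun j => Level N (S.cplx j))
      (hZ.differentiable ht) (hγ.differentiable one_ne_zero) j
  -- Monotonicity of the lower integral needs no measurability of K or of the majorant in s.
  · refine MeasureTheory.setLIntegral_mono' measurableSet_Icc fun s hs => ?_
    rw [← ofReal_norm]
    exact ENNReal.ofReal_le_ofReal
      (norm_virtualDisplacement_le hZ hη (γ s) _ h0 (h s hs).1 (h s hs).2 ht j)
  · obtain ⟨z, hz, hzx⟩ := (hform.2 x).1 hx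
    obtain ⟨w, hw, hwy⟩ := (hform.2 y).1 hy
    -- The factor 1 is L^0 η, the weight of the first coordinate.
    refine ⟨(∑ k, ‖(w 0 - z 0) k‖) / m * 1, fun t ht => ?_⟩
    rw [hzx t ht, hwy t ht, hz.eq_flow hZ ht, hw.eq_flow hZ ht]
    refine (norm_rePos_sub_le _ _).trans ?_
    exact norm_sub_le_of_rate_le hZ hη hm hmL hβ (z 0) (w 0) ht 0 fun _ => le_rfl
  · exact ⟨(∑ k, ‖(z₁ - z₀) k‖) / m * M, fun t ht j =>
      norm_sub_le_of_rate_le hZ hη hm hmL hβ z₀ z₁ ht j fun z => hM z t ht j⟩
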